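/- Let $k\in\mathbb R$ with $e^k+e^{-k}\in\mathbb Z\setminus\{2\}$, and let $G_k$ be the group of real matrices $$\begin{pmatrix} e^{kz}&0&0&x\\0&e^{-kz}&0&y\\0&0&1&z\\0&0&0&1\end{pmatrix},\qquad x,y,z\in\mathbb R .$$ Let $\Gamma\subset G_k$ be a discrete subgroup such that $N=G_k/\Gamma$ is compact. The right-invariant $1$-forms $dx-kx\,dz$, $dy+ky\,dz$, $dz$ on $G_k$ descend to $1$-forms $\alpha,\beta,\gamma$ on $N$. Let $n$ be a nonzero integer, $\lambda\in\mathbb R$, and let $\pi:M\to N$ be a smooth principal $S^1$-bundle ($S^1=\mathbb R/\mathbb Z$) with a connection form $\eta$ of curvature $d\eta=n\lambda\,\alpha\wedge\beta$ (so that the bundle has real Chern class $n\lambda[\alpha\wedge\beta]$); the pull-backs of $\alpha,\beta,\gamma$ to the $4$-manifold $M$ are denoted by the same letters. For $(t_1,t_2,t_3)\in\mathbb R^3$ with $t_1t_2\neq0$ and $t_1t_2\neq nk\lambda t_3^2$, and for $(s_1,s_2,s_3)\in\mathbb R^3$ with $s_1s_2\neq0$ and $s_1s_2\neq nk\lambda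 s_3^2$, put $$\Omega_{(t_1,t_2,t_3)}=t_1\,\alpha\wedge\eta+t_2\,\beta\wedge\gamma+t_3\,(n\lambda\,\alpha\wedge\beta-k\,\gamma\wedge\eta),$$ $$\Omega_{(s_1,s_2,s_3)}=s_1\,\beta\wedge\eta+s_2\,\alpha\wedge\gamma+s_3\,(n\lambda\,\alpha\wedge\beta+k\,\gamma\wedge\eta).$$ An infinitesimal automorphism of (the conformal class of) a $2$-form $\Omega$ is a smooth vector field $X$ on $M$ with $L_X\Omega=f\,\Omega$ for some function $f:M\to\mathbb R$. Then every infinitesimal automorphism $X$ of $\Omega_{(t_1,t_2,t_3)}$ satisfies $$L_X\Omega_{(t_1,t_2,t_3)}=k\,\gamma(X)\,\Omega_{(t_1,t_2,t_3)},$$ and every infinitesimal automorphism $X$ of $\Omega_{(s_1,s_2,s_3)}$ satisfies $$L_X\Omega_{(s_1,s_2,s_3)}=-k\,\gamma(X)\,\Omega_{(s_1,s_2,s_3)}.$$ In other words, for each of these forms $\Omega$ the extended Lee homomorphism $X\mapsto \mu_X+\omega(X)$ is defined and vanishes on all infinitesimal automorphisms; here $L_X\Omega=\mu_X\Omega$ and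 $\omega$ is the Lee form of $\Omega$, that is, the closed $1$-form with $d\Omega=-\omega\wedge\Omega$. -/

import Mathlib

open scoped Manifold ContDiff

section Forms

variable {E : Type*} [NormedAddCommGroup E] [NormedSpace ℝ E] {H : Type*} [TopologicalSpace H]
  (I : ModelWithCorners ℝ E H) (M : Type*) [TopologicalSpace M] [ChartedSpace H M]
  {E' : Type*} [NormedAddCommGroup E'] [NormedSpace ℝ E'] {H' : Type*} [TopologicalSpace H']
  (J : ModelWithCorners ℝ E' H') {N : Type*} [TopologicalSpace N] [ChartedSpace H' N]

/-- Vector fields. -/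
abbrev VecField := ∀ p : M, TangentSpace I p

/-- Differential 1-forms. -/
abbrev OneForm := ∀ p : M, TangentSpace I p →L[ℝ] ℝ

/-- Differential 2-forms. -/
abbrev TwoForm := ∀ p : M, TangentSpace I p [⋀^Fin 2]→L[ℝ] ℝ

variable {I M}

/-- Smoothness of a vector field. -/
def IsSmoothVecField [IsManifold I 1 M] (X : VecField I M) : Prop :=
  ContMDiff I I.tangent ∞ (fun p => (⟨p, X p⟩ : TangentBundle I M))

/-- Smoothness of a 1-form, as a section of the cotangent bundle. -/
def IsSmoothOneForm [IsManifold I 1 M] (θ : OneForm I M) : Prop :=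
  ContMDiff I (I.prod 𝓘(ℝ, E →L[ℝ] ℝ)) ∞ (fun p => Bundle.TotalSpace.mk' (E →L[ℝ] ℝ)
    (E := fun p : M => TangentSpace I p →L[ℝ] Bundle.Trivial M ℝ p) p (θ p))

/-- The wedge product of two 1-forms, `(θ ∧ ζ)(u, v) = θ(u) ζ(v) - θ(v) ζ(u)`. -/
noncomputable def OneForm.wedge (θ ζ : OneForm I M) : TwoForm I M := fun p =>
  ContinuousMultilinearMap.alternatization
    ((ContinuousMultilinearMap.mkPiAlgebra ℝ (Fin 2) ℝ).compContinuousLinearMap ![θ p, ζ p])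

theorem OneForm.wedge_apply (θ ζ : OneForm I M) (p : M) (u v : TangentSpace I p) :
    θ.wedge ζ p ![u, v] = θ p u * ζ p v - θ p v * ζ p u := by
  have h := Matrix.det_apply (Matrix.of ![![θ p u, ζ p u], ![θ p v, ζ p v]])
  rw [Matrix.det_fin_two_of] at h
  rw [OneForm.wedge, ContinuousMultilinearMap.alternatization_apply_apply, mul_comm (θ p v), h]
  refine Finset.sum_congr rfl fun σ _ => ?_
  congr 1
  rw [ContinuousMultilinearMap.compContinuousLinearMap_apply,
    ContinuousMultilinearMap.mkPiAlgebra_apply]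
  refine Finset.prod_congr rfl fun i _ => ?_
  rw [Function.comp_apply]
  generalize σ i = j
  fin_cases i <;> fin_cases j <;> rfl

/-- The pull-back of a 1-form. -/
noncomputable def OneForm.pullback (f : M → N) (θ : OneForm J N) : OneForm I M :=
  fun p => (θ (f p)).comp (mfderiv I J f p)

/-- `Θ = dθ` for a 1-form `θ`, through the invariant formula
`dθ(U, V) = U(θ(V)) - V(θ(U)) - θ([U, V])`. -/
def IsExtDeriv [IsManifold I 1 M] (θ : OneForm I M) (Θ : TwoForm I M) : Prop :=
  ∀ U V : VecField I M, IsSmoothVecField U → IsSmoothVecField V → ∀ p : M,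
    Θ p ![U p, V p] =
      mvfderiv I (fun q => θ q (V q)) p (U p) - mvfderiv I (fun q => θ q (U q)) p (V p)
        - θ p (VectorField.mlieBracket I U V p)

/-- The values of the exterior derivative of a 2-form on vector fields, through the invariant
formula. -/
noncomputable def TwoForm.extDerivApply (Ω : TwoForm I M) (U V W : VecField I M) (p : M) : ℝ :=
  mvfderiv I (fun q => Ω q ![V q, W q]) p (U p)
    - mvfderiv I (fun q => Ω q ![U q, W q]) p (V p)
    + mvfderiv I (fun q => Ω q ![U q, V q]) p (W p)
    - Ω p ![VectorField.mlieBracket I U V p, W p]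
    + Ω p ![VectorField.mlieBracket I U W p, V p]
    - Ω p ![VectorField.mlieBracket I V W p, U p]

/-- The values of `θ ∧ Ω` for a 1-form `θ` and a 2-form `Ω`. -/
noncomputable def OneForm.wedgeTwoApply (θ : OneForm I M) (Ω : TwoForm I M) (p : M)
    (u v w : TangentSpace I p) : ℝ :=
  θ p u * Ω p ![v, w] - θ p v * Ω p ![u, w] + θ p w * Ω p ![u, v]

/-- `θ` is a Lee form of `Ω`: a closed (smooth) 1-form with `dΩ = -θ ∧ Ω`. -/
structure IsLeeForm [IsManifold I 1 M] (Ω : TwoForm I M) (θ : OneForm I M) : Prop where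
  smooth : IsSmoothOneForm θ
  closed : IsExtDeriv θ 0
  extDeriv_eq : ∀ U V W : VecField I M, IsSmoothVecField U → IsSmoothVecField V →
    IsSmoothVecField W → ∀ p : M,
      Ω.extDerivApply U V W p = -θ.wedgeTwoApply Ω p (U p) (V p) (W p)

/-- `Θ` is the Lie derivative `L_X Ω`, through
`(L_X Ω)(U, V) = X(Ω(U, V)) - Ω([X, U], V) - Ω(U, [X, V])`. -/
def IsLieDeriv [IsManifold I 1 M] (X : VecField I M) (Ω Θ : TwoForm I M) : Prop :=
  ∀ U V : VecField I M, IsSmoothVecField U → IsSmoothVecField V → ∀ p : M,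
    Θ p ![U p, V p] =
      mvfderiv I (fun q => Ω q ![U q, V q]) p (X p)
        - Ω p ![VectorField.mlieBracket I X U p, V p]
        - Ω p ![U p, VectorField.mlieBracket I X V p]

/-- `L_X Ω = f Ω`. -/
def IsConformalAlong [IsManifold I 1 M] (X : VecField I M) (Ω : TwoForm I M) (f : M → ℝ) : Prop :=
  IsLieDeriv X Ω (fun p => f p • Ω p)

/-- `X` is an infinitesimal automorphism of the conformal class of `Ω`: a smooth vector field with
`L_X Ω = f Ω` for some function `f`. -/
def IsInfinitesimalAut [IsManifold I 1 M] (Ω : TwoForm I M) (X : VecField I M) : Prop :=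
  IsSmoothVecField X ∧ ∃ f : M → ℝ, IsConformalAlong X Ω f

/-- `l` is the value at `X` of the extended Lee homomorphism of `Ω`: `l = μ + θ(X)`, where
`L_X Ω = μ Ω` and `θ` is the Lee form of `Ω`. -/
def IsLeeHomValue [IsManifold I 1 M] (Ω : TwoForm I M) (X : VecField I M) (l : M → ℝ) : Prop :=
  ∃ (θ : OneForm I M) (μ : M → ℝ), IsLeeForm Ω θ ∧ IsConformalAlong X Ω μ ∧
    ∀ p, l p = μ p + θ p (X p)

/-- The forms `t₁ (α ∧ η) + t₂ (β ∧ γ) + t₃ (c (α ∧ β) - k (γ ∧ η))`. -/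
noncomputable def omegaT (α β γ η : OneForm I M) (c k t₁ t₂ t₃ : ℝ) : TwoForm I M :=
  t₁ • α.wedge η + t₂ • β.wedge γ + t₃ • (c • α.wedge β - k • γ.wedge η)

/-- The forms `s₁ (β ∧ η) + s₂ (α ∧ γ) + s₃ (c (α ∧ β) + k (γ ∧ η))`. -/
noncomputable def omegaS (α β γ η : OneForm I M) (c k s₁ s₂ s₃ : ℝ) : TwoForm I M :=
  s₁ • β.wedge η + s₂ • α.wedge γ + s₃ • (c • α.wedge β + k • γ.wedge η)

/-- `π : M → N` is a smooth principal bundle for the given action of the circle group on `M`. -/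
structure IsPrincipalCircleBundle [MulAction Circle M] (π : M → N) : Prop where
  contMDiff_smul : ContMDiff ((𝓡 1).prod I) I ∞ (fun q : Circle × M => q.1 • q.2)
  contMDiff_proj : ContMDiff I J ∞ π
  exists_trivialization : ∀ b : N, ∃ e : Bundle.Trivialization Circle π, b ∈ e.baseSet ∧
    ContMDiffOn I (J.prod (𝓡 1)) ∞ e e.source ∧
    ContMDiffOn (J.prod (𝓡 1)) I ∞ e.toOpenPartialHomeomorph.symm e.target ∧
    ∀ (c : Circle) (p : M), p ∈ e.source →
      c • p ∈ e.source ∧ e (c • p) = ((e p).1, c * (e p).2)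

/-- `η` is a connection form for the given circle action: smooth, invariant, and equal to `1` on
the velocity of the orbits `s ↦ exp(2πis) · p`, that is, on the fundamental vector field of the
action of `ℝ/ℤ`. -/
structure IsConnectionForm [IsManifold I 1 M] [MulAction Circle M] (η : OneForm I M) : Prop where
  smooth : IsSmoothOneForm η
  invariant : ∀ c : Circle, OneForm.pullback I (fun p : M => c • p) η = η
  vertical : ∀ (p : M) (s : ℝ), η (Circle.exp (2 * Real.pi * s) • p)
    (mfderiv 𝓘(ℝ, ℝ) I (fun s : ℝ => Circle.exp (2 * Real.pi * s) • p) s (1 : ℝ)) = 1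

end Forms

/-- The solvable group of the matrices `SolvGroup.toMatrix k g`, in its global coordinates
`(x, y, z) ∈ ℝ³`. -/
def SolvGroup (_k : ℝ) : Type := ℝ × ℝ × ℝ

namespace SolvGroup

variable {k : ℝ}

instance : TopologicalSpace (SolvGroup k) := inferInstanceAs (TopologicalSpace (ℝ × ℝ × ℝ))

instance : T2Space (SolvGroup k) := inferInstanceAs (T2Space (ℝ × ℝ × ℝ))

instance : ChartedSpace (ℝ × ℝ × ℝ) (SolvGroup k) :=
  inferInstanceAs (ChartedSpace (ℝ × ℝ × ℝ) (ℝ × ℝ × ℝ))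

instance : IsManifold 𝓘(ℝ, ℝ × ℝ × ℝ) ∞ (SolvGroup k) :=
  inferInstanceAs (IsManifold 𝓘(ℝ, ℝ × ℝ × ℝ) ∞ (ℝ × ℝ × ℝ))

/-- The coordinate `x`. -/
def x (g : SolvGroup k) : ℝ := Prod.fst (α := ℝ) (β := ℝ × ℝ) g

/-- The coordinate `y`. -/
def y (g : SolvGroup k) : ℝ := Prod.fst (Prod.snd (α := ℝ) (β := ℝ × ℝ) g)

/-- The coordinate `z`. -/
def z (g : SolvGroup k) : ℝ := Prod.snd (Prod.snd (α := ℝ) (β := ℝ × ℝ) g)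

/-- The element with given coordinates. -/
def mk (a b c : ℝ) : SolvGroup k := ((a, b, c) : ℝ × ℝ × ℝ)

@[simp] theorem x_mk (a b c : ℝ) : (mk a b c : SolvGroup k).x = a := rfl
@[simp] theorem y_mk (a b c : ℝ) : (mk a b c : SolvGroup k).y = b := rfl
@[simp] theorem z_mk (a b c : ℝ) : (mk a b c : SolvGroup k).z = c := rfl

@[ext] theorem ext {g h : SolvGroup k} (hx : g.x = h.x) (hy : g.y = h.y) (hz : g.z = h.z) :
    g = h :=
  Prod.ext hx (Prod.ext hy hz)

/-- The matrix with coordinates `(x, y, z)`. -/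
noncomputable def toMatrix (g : SolvGroup k) : Matrix (Fin 4) (Fin 4) ℝ :=
  !![Real.exp (k * g.z), 0, 0, g.x;
     0, Real.exp (-(k * g.z)), 0, g.y;
     0, 0, 1, g.z;
     0, 0, 0, 1]

noncomputable instance : Mul (SolvGroup k) :=
  ⟨fun g h => mk (Real.exp (k * g.z) * h.x + g.x) (Real.exp (-(k * g.z)) * h.y + g.y) (h.z + g.z)⟩

instance : One (SolvGroup k) := ⟨mk 0 0 0⟩

noncomputable instance : Inv (SolvGroup k) :=
  ⟨fun g => mk (-(Real.exp (-(k * g.z)) * g.x)) (-(Real.exp (k * g.z) * g.y)) (-g.z)⟩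

theorem mul_def (g h : SolvGroup k) :
    g * h = mk (Real.exp (k * g.z) * h.x + g.x) (Real.exp (-(k * g.z)) * h.y + g.y)
      (h.z + g.z) := rfl

theorem one_def : (1 : SolvGroup k) = mk 0 0 0 := rfl

theorem inv_def (g : SolvGroup k) :
    g⁻¹ = mk (-(Real.exp (-(k * g.z)) * g.x)) (-(Real.exp (k * g.z) * g.y)) (-g.z) := rfl

noncomputable instance : Group (SolvGroup k) :=
  Group.ofLeftAxioms
    (fun a b c => by
      ext <;> simp only [mul_def, x_mk, y_mk, z_mk, mul_add, neg_add, Real.exp_add] <;> ring)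
    (fun a => by ext <;> simp [mul_def, one_def])
    (fun a => by ext <;> simp [mul_def, one_def, inv_def])

/-- The group law is matrix multiplication. -/
theorem toMatrix_mul (g h : SolvGroup k) : (g * h).toMatrix = g.toMatrix * h.toMatrix := by
  ext i j
  fin_cases i <;> fin_cases j <;>
    simp [toMatrix, mul_def, Matrix.mul_apply, Fin.sum_univ_four, mul_add, Real.exp_add, mul_comm]

theorem toMatrix_one : (1 : SolvGroup k).toMatrix = 1 := by
  ext i j
  fin_cases i <;> fin_cases j <;> simp [toMatrix, one_def]

theorem toMatrix_injective : Function.Injective (toMatrix : SolvGroup k → _) := by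
  intro g h e
  have e1 := congrFun (congrFun e 0) 3
  have e2 := congrFun (congrFun e 1) 3
  have e3 := congrFun (congrFun e 2) 3
  simp [toMatrix] at e1 e2 e3
  exact ext e1 e2 e3

/-- Right translations are smooth. -/
theorem contMDiff_mul_right (d : SolvGroup k) :
    ContMDiff 𝓘(ℝ, ℝ × ℝ × ℝ) 𝓘(ℝ, ℝ × ℝ × ℝ) ∞ (fun g : SolvGroup k => g * d) := by
  have h : ContDiff ℝ ∞ (fun p : ℝ × ℝ × ℝ =>
      ((Real.exp (k * p.2.2) * d.x + p.1, Real.exp (-(k * p.2.2)) * d.y + p.2.1,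
        d.z + p.2.2) : ℝ × ℝ × ℝ)) := by fun_prop
  exact h.contMDiff

instance : IsTopologicalGroup (SolvGroup k) where
  continuous_mul := by
    change Continuous (fun p : (ℝ × ℝ × ℝ) × (ℝ × ℝ × ℝ) =>
      ((Real.exp (k * p.1.2.2) * p.2.1 + p.1.1, Real.exp (-(k * p.1.2.2)) * p.2.2.1 + p.1.2.1,
        p.2.2.2 + p.1.2.2) : ℝ × ℝ × ℝ))
    fun_prop
  continuous_inv := by
    change Continuous (fun p : ℝ × ℝ × ℝ =>
      ((-(Real.exp (-(k * p.2.2)) * p.1), -(Real.exp (k * p.2.2) * p.2.1), -p.2.2) :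
        ℝ × ℝ × ℝ))
    fun_prop

section Quotient

variable (Γ : Subgroup (SolvGroup k))

/-- A chosen representative of a coset. -/
noncomputable def lift (b : SolvGroup k ⧸ Γ) : SolvGroup k := Quotient.out b

theorem mk_lift (b : SolvGroup k ⧸ Γ) : QuotientGroup.mk (lift Γ b) = b :=
  QuotientGroup.out_eq' b

variable [DiscreteTopology Γ]

theorem isLocalHomeomorph_quotientMk :
    IsLocalHomeomorph (QuotientGroup.mk : SolvGroup k → SolvGroup k ⧸ Γ) :=
  (Γ.isQuotientCoveringMap ⟨inferInstance⟩).isCoveringMap.isLocalHomeomorph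

/-- The charts of the quotient are the local inverses of the projection from the group. -/
noncomputable instance : ChartedSpace (ℝ × ℝ × ℝ) (SolvGroup k ⧸ Γ) :=
  (isLocalHomeomorph_quotientMk Γ).chartedSpaceOfRightInverse (mk_lift Γ)

/-- A continuous local lift of the projection is locally a right translation. -/
theorem eventually_eq_mul_right {F : SolvGroup k → SolvGroup k} {u : SolvGroup k}
    (hc : ContinuousAt F u)
    (hF : ∀ᶠ v in nhds u,
      (QuotientGroup.mk (F v) : SolvGroup k ⧸ Γ) = QuotientGroup.mk v) :
    ∃ d ∈ Γ, F =ᶠ[nhds u] fun v => v * d := by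
  have hΓ : ∀ᶠ v in nhds u, v⁻¹ * F v ∈ Γ := hF.mono fun v hv => QuotientGroup.eq.1 hv.symm
  have hd : ContinuousAt (fun v => v⁻¹ * F v) u := continuousAt_inv.mul hc
  have hmem : u⁻¹ * F u ∈ Γ := hΓ.self_of_nhds
  obtain ⟨W, hW, hWd⟩ := isDiscrete_iff_forall_mem_exists_isOpen.1
    (⟨inferInstance⟩ : IsDiscrete (Γ : Set (SolvGroup k))) _ hmem
  have hW' : W ∈ nhds (u⁻¹ * F u) := hW.mem_nhds (by
    have : u⁻¹ * F u ∈ W ∩ (Γ : Set (SolvGroup k)) := by rw [hWd]; rfl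
    exact this.1)
  refine ⟨u⁻¹ * F u, hmem, ?_⟩
  filter_upwards [hΓ, hd.eventually hW'] with v h1 h2
  have h3 : v⁻¹ * F v ∈ W ∩ (Γ : Set (SolvGroup k)) := ⟨h2, h1⟩
  rw [hWd] at h3
  rw [← Set.mem_singleton_iff.1 h3]
  group

theorem contMDiffAt_of_mk_eq {F : SolvGroup k → SolvGroup k} {u : SolvGroup k}
    (hc : ContinuousAt F u)
    (hF : ∀ᶠ v in nhds u,
      (QuotientGroup.mk (F v) : SolvGroup k ⧸ Γ) = QuotientGroup.mk v) :
    ContMDiffAt 𝓘(ℝ, ℝ × ℝ × ℝ) 𝓘(ℝ, ℝ × ℝ × ℝ) ∞ F u := by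
  obtain ⟨d, -, hd⟩ := eventually_eq_mul_right Γ hc hF
  exact (contMDiff_mul_right d u).congr_of_eventuallyEq hd

/-- The transition between two local inverses of the projection is smooth. -/
theorem contMDiffOn_transition (a b : SolvGroup k) :
    ContMDiffOn 𝓘(ℝ, ℝ × ℝ × ℝ) 𝓘(ℝ, ℝ × ℝ × ℝ) ∞
      (((isLocalHomeomorph_quotientMk Γ).localInverseAt a).symm.trans
        ((isLocalHomeomorph_quotientMk Γ).localInverseAt b))
      (((isLocalHomeomorph_quotientMk Γ).localInverseAt a).symm.trans
        ((isLocalHomeomorph_quotientMk Γ).localInverseAt b)).source := by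
  intro u hu
  refine (contMDiffAt_of_mk_eq Γ (OpenPartialHomeomorph.continuousAt _ hu)
    ?_).contMDiffWithinAt
  filter_upwards [(OpenPartialHomeomorph.open_source _).mem_nhds hu] with v hv
  have h1 : ((isLocalHomeomorph_quotientMk Γ).localInverseAt a).symm v ∈
    ((isLocalHomeomorph_quotientMk Γ).localInverseAt b).source := hv.2
  rw [OpenPartialHomeomorph.coe_trans, Function.comp_apply,
    (isLocalHomeomorph_quotientMk Γ).apply_localInverseAt_of_mem h1,
    (isLocalHomeomorph_quotientMk Γ).localInverseAt_symm]

instance : IsManifold 𝓘(ℝ, ℝ × ℝ × ℝ) ∞ (SolvGroup k ⧸ Γ) := by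
  refine isManifold_of_contDiffOn _ _ _ ?_
  rintro e e' ⟨q, rfl⟩ ⟨q', rfl⟩
  have h := contMDiffOn_iff_contDiffOn.1 (show ContMDiffOn 𝓘(ℝ, ℝ × ℝ × ℝ) 𝓘(ℝ, ℝ × ℝ × ℝ) ∞
    (M := ℝ × ℝ × ℝ) (M' := ℝ × ℝ × ℝ) _ _ from contMDiffOn_transition Γ (lift Γ q) (lift Γ q'))
  refine h.mono ?_
  rintro u ⟨⟨⟨-, h1⟩, ⟨h2, -⟩⟩, -⟩
  exact ⟨h1, h2⟩

/-- Right translations as diffeomorphisms. -/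
noncomputable def mulRight (d : SolvGroup k) :
    Diffeomorph 𝓘(ℝ, ℝ × ℝ × ℝ) 𝓘(ℝ, ℝ × ℝ × ℝ) (SolvGroup k) (SolvGroup k) ∞ where
  toEquiv := Equiv.mulRight d
  contMDiff_toFun := contMDiff_mul_right d
  contMDiff_invFun := contMDiff_mul_right d⁻¹

/-- The projection from the group to the quotient is a local diffeomorphism. -/
theorem isLocalDiffeomorph_quotientMk :
    IsLocalDiffeomorph 𝓘(ℝ, ℝ × ℝ × ℝ) 𝓘(ℝ, ℝ × ℝ × ℝ) ∞
      (QuotientGroup.mk : SolvGroup k → SolvGroup k ⧸ Γ) := by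
  have hl : ∀ b : SolvGroup k ⧸ Γ, IsLocalDiffeomorphAt 𝓘(ℝ, ℝ × ℝ × ℝ) 𝓘(ℝ, ℝ × ℝ × ℝ) ∞
      (QuotientGroup.mk : SolvGroup k → SolvGroup k ⧸ Γ) (lift Γ b) := by
    intro b
    refine ⟨⟨((isLocalHomeomorph_quotientMk Γ).localInverseAt (lift Γ b)).symm.toPartialEquiv,
      OpenPartialHomeomorph.open_source _, OpenPartialHomeomorph.open_target _, ?_, ?_⟩,
      (isLocalHomeomorph_quotientMk Γ).self_mem_localInverseAt_target, ?_⟩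
    · have h := contMDiffOn_chart_symm (I := 𝓘(ℝ, ℝ × ℝ × ℝ)) (n := ∞) (x := b)
      refine ContMDiffOn.mono h ?_
      intro u hu
      exact ⟨trivial, hu⟩
    · have h := contMDiffOn_chart (I := 𝓘(ℝ, ℝ × ℝ × ℝ)) (n := ∞) (x := b)
      refine ContMDiffOn.mono h ?_
      intro u hu
      exact ⟨hu, trivial⟩
    · intro u _
      exact (congrFun ((isLocalHomeomorph_quotientMk Γ).localInverseAt_symm _) u).symm
  intro g
  set b : SolvGroup k ⧸ Γ := QuotientGroup.mk g
  have hd : g⁻¹ * lift Γ b ∈ Γ := QuotientGroup.eq.1 (mk_lift Γ b).symm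
  have h1 := (mulRight (g⁻¹ * lift Γ b)).isLocalDiffeomorph g
  have h2 := hl b
  have e : mulRight (g⁻¹ * lift Γ b) g = lift Γ b := mul_inv_cancel_left g _
  rw [← e] at h2
  have h3 := h1.comp _ _ h2
  convert h3 using 1
  funext v
  exact (QuotientGroup.mk_mul_of_mem v hd).symm

/-- The 1-form on the quotient whose pull-back to the group is `θ`, when `θ` is invariant under right
translations. -/
noncomputable def descend (θ : OneForm 𝓘(ℝ, ℝ × ℝ × ℝ) (SolvGroup k)) :
    OneForm 𝓘(ℝ, ℝ × ℝ × ℝ) (SolvGroup k ⧸ Γ) := fun b =>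
  (θ (lift Γ b)).comp (mfderiv 𝓘(ℝ, ℝ × ℝ × ℝ) 𝓘(ℝ, ℝ × ℝ × ℝ)
    (QuotientGroup.mk : SolvGroup k → SolvGroup k ⧸ Γ) (lift Γ b)).inverse

/-- A right-invariant form on the group is the pull-back of the form it induces on the quotient. -/
theorem pullback_descend (θ : OneForm 𝓘(ℝ, ℝ × ℝ × ℝ) (SolvGroup k))
    (hθ : ∀ d : SolvGroup k, OneForm.pullback (I := 𝓘(ℝ, ℝ × ℝ × ℝ)) 𝓘(ℝ, ℝ × ℝ × ℝ)
      (fun g : SolvGroup k => g * d) θ = θ) :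
    OneForm.pullback (I := 𝓘(ℝ, ℝ × ℝ × ℝ)) 𝓘(ℝ, ℝ × ℝ × ℝ)
      (QuotientGroup.mk : SolvGroup k → SolvGroup k ⧸ Γ) (descend Γ θ) = θ := by
  have hq := isLocalDiffeomorph_quotientMk Γ
  funext g
  set d : SolvGroup k := g⁻¹ * lift Γ (QuotientGroup.mk g) with hd
  have hdΓ : d ∈ Γ := QuotientGroup.eq.1 (mk_lift Γ (QuotientGroup.mk g)).symm
  have e : g * d = lift Γ (QuotientGroup.mk g) := mul_inv_cancel_left g _
  have hcomp : mfderiv 𝓘(ℝ, ℝ × ℝ × ℝ) 𝓘(ℝ, ℝ × ℝ × ℝ)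
      (QuotientGroup.mk : SolvGroup k → SolvGroup k ⧸ Γ) g =
      (mfderiv 𝓘(ℝ, ℝ × ℝ × ℝ) 𝓘(ℝ, ℝ × ℝ × ℝ)
        (QuotientGroup.mk : SolvGroup k → SolvGroup k ⧸ Γ) (g * d)).comp
      (mfderiv 𝓘(ℝ, ℝ × ℝ × ℝ) 𝓘(ℝ, ℝ × ℝ × ℝ) (fun g : SolvGroup k => g * d) g) := by
    have h := mfderiv_comp g ((hq (g * d)).mdifferentiableAt (by simp))
      ((contMDiff_mul_right d).mdifferentiableAt (x := g) (by simp))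
    rw [← h]
    congr 1
    funext v
    exact (QuotientGroup.mk_mul_of_mem v hdΓ).symm
  have h1 := congrFun (hθ d) g
  have key : ∀ a : SolvGroup k, g * d = a → ∀ w : TangentSpace 𝓘(ℝ, ℝ × ℝ × ℝ) (g * d),
      θ a ((mfderiv 𝓘(ℝ, ℝ × ℝ × ℝ) 𝓘(ℝ, ℝ × ℝ × ℝ)
        (QuotientGroup.mk : SolvGroup k → SolvGroup k ⧸ Γ) a).inverse
        (mfderiv 𝓘(ℝ, ℝ × ℝ × ℝ) 𝓘(ℝ, ℝ × ℝ × ℝ)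
        (QuotientGroup.mk : SolvGroup k → SolvGroup k ⧸ Γ) (g * d) w)) = θ (g * d) w := by
    rintro _ rfl w
    have hi : (mfderiv 𝓘(ℝ, ℝ × ℝ × ℝ) 𝓘(ℝ, ℝ × ℝ × ℝ)
      (QuotientGroup.mk : SolvGroup k → SolvGroup k ⧸ Γ) (g * d)).IsInvertible :=
      ⟨(hq (g * d)).mfderivToContinuousLinearEquiv (by simp), rfl⟩
    rw [hi.inverse_apply_eq.2 rfl]
  rw [← h1]
  ext w
  refine Eq.trans ?_ (key _ e (mfderiv 𝓘(ℝ, ℝ × ℝ × ℝ) 𝓘(ℝ, ℝ × ℝ × ℝ)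
    (fun g : SolvGroup k => g * d) g w))
  exact congrArg (fun u => θ (lift Γ (QuotientGroup.mk g)) ((mfderiv 𝓘(ℝ, ℝ × ℝ × ℝ)
    𝓘(ℝ, ℝ × ℝ × ℝ) (QuotientGroup.mk : SolvGroup k → SolvGroup k ⧸ Γ)
    (lift Γ (QuotientGroup.mk g))).inverse u)) (DFunLike.congr_fun hcomp w)

/-- The form `dx - k x dz`. -/
noncomputable def alphaG (k : ℝ) : OneForm 𝓘(ℝ, ℝ × ℝ × ℝ) (SolvGroup k) := fun g =>
  mvfderiv 𝓘(ℝ, ℝ × ℝ × ℝ) x g - (k * g.x) • mvfderiv 𝓘(ℝ, ℝ × ℝ × ℝ) z g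

/-- The form `dy + k y dz`. -/
noncomputable def betaG (k : ℝ) : OneForm 𝓘(ℝ, ℝ × ℝ × ℝ) (SolvGroup k) := fun g =>
  mvfderiv 𝓘(ℝ, ℝ × ℝ × ℝ) y g + (k * g.y) • mvfderiv 𝓘(ℝ, ℝ × ℝ × ℝ) z g

/-- The form `dz`. -/
noncomputable def gammaG (k : ℝ) : OneForm 𝓘(ℝ, ℝ × ℝ × ℝ) (SolvGroup k) := fun g =>
  mvfderiv 𝓘(ℝ, ℝ × ℝ × ℝ) z g

theorem mvfderiv_eq_of_hasFDerivAt {f : SolvGroup k → ℝ} (g : SolvGroup k)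
    (L : ℝ × ℝ × ℝ →L[ℝ] ℝ)
    (hf : HasFDerivAt (E := ℝ × ℝ × ℝ) (fun v : ℝ × ℝ × ℝ => f v) L g) (w : ℝ × ℝ × ℝ) :
    mvfderiv 𝓘(ℝ, ℝ × ℝ × ℝ) f g w = L w := by
  have h : HasMFDerivAt 𝓘(ℝ, ℝ × ℝ × ℝ) 𝓘(ℝ, ℝ) (M := ℝ × ℝ × ℝ)
      (fun v : ℝ × ℝ × ℝ => f v) g L :=
    hf.hasMFDerivAt
  exact DFunLike.congr_fun h.mfderiv w

theorem mvfderiv_x (g : SolvGroup k) (w : ℝ × ℝ × ℝ) :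
    mvfderiv 𝓘(ℝ, ℝ × ℝ × ℝ) (x : SolvGroup k → ℝ) g w = w.1 :=
  mvfderiv_eq_of_hasFDerivAt g (.fst ℝ ℝ (ℝ × ℝ)) (hasFDerivAt_fst (E := ℝ) (F := ℝ × ℝ)) w

theorem mvfderiv_y (g : SolvGroup k) (w : ℝ × ℝ × ℝ) :
    mvfderiv 𝓘(ℝ, ℝ × ℝ × ℝ) (y : SolvGroup k → ℝ) g w = w.2.1 :=
  mvfderiv_eq_of_hasFDerivAt g ((ContinuousLinearMap.fst ℝ ℝ ℝ).comp (.snd ℝ ℝ (ℝ × ℝ)))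
    ((ContinuousLinearMap.fst ℝ ℝ ℝ).comp (.snd ℝ ℝ (ℝ × ℝ))).hasFDerivAt w

theorem mvfderiv_z (g : SolvGroup k) (w : ℝ × ℝ × ℝ) :
    mvfderiv 𝓘(ℝ, ℝ × ℝ × ℝ) (z : SolvGroup k → ℝ) g w = w.2.2 :=
  mvfderiv_eq_of_hasFDerivAt g ((ContinuousLinearMap.snd ℝ ℝ ℝ).comp (.snd ℝ ℝ (ℝ × ℝ)))
    ((ContinuousLinearMap.snd ℝ ℝ ℝ).comp (.snd ℝ ℝ (ℝ × ℝ))).hasFDerivAt w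

/-- The differential of a right translation in the coordinates. -/
theorem mfderiv_mul_right (d g : SolvGroup k) (w : ℝ × ℝ × ℝ) :
    (mfderiv 𝓘(ℝ, ℝ × ℝ × ℝ) 𝓘(ℝ, ℝ × ℝ × ℝ) (fun g : SolvGroup k => g * d) g w : ℝ × ℝ × ℝ) =
      (w.1 + k * Real.exp (k * g.z) * d.x * w.2.2,
        w.2.1 - k * Real.exp (-(k * g.z)) * d.y * w.2.2, w.2.2) := by
  have h1 := hasFDerivAt_fst (𝕜 := ℝ) (E := ℝ) (F := ℝ × ℝ) (p := g)
  have h2 : HasFDerivAt (fun p : ℝ × ℝ × ℝ => p.2.1)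
    ((ContinuousLinearMap.fst ℝ ℝ ℝ).comp (.snd ℝ ℝ (ℝ × ℝ))) g :=
    ((ContinuousLinearMap.fst ℝ ℝ ℝ).comp (.snd ℝ ℝ (ℝ × ℝ))).hasFDerivAt
  have h3 : HasFDerivAt (fun p : ℝ × ℝ × ℝ => p.2.2)
    ((ContinuousLinearMap.snd ℝ ℝ ℝ).comp (.snd ℝ ℝ (ℝ × ℝ))) g :=
    ((ContinuousLinearMap.snd ℝ ℝ ℝ).comp (.snd ℝ ℝ (ℝ × ℝ))).hasFDerivAt
  have h := (((h3.const_mul k).exp.mul_const d.x).add h1).prodMk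
    (((((h3.const_mul k).neg.exp.mul_const d.y).add h2)).prodMk (h3.const_add d.z))
  have h' := DFunLike.congr_fun (h.hasMFDerivAt.mfderiv) w
  refine Eq.trans h' ?_
  refine Prod.ext (α := ℝ) (β := ℝ × ℝ) ?_ (Prod.ext (α := ℝ) (β := ℝ) ?_ rfl)
  · change d.x * (Real.exp (k * g.z) * (k * w.2.2)) + w.1 = _
    ring
  · change d.y * (Real.exp (-(k * g.z)) * -(k * w.2.2)) + w.2.1 = _
    ring

theorem alphaG_rightInvariant (d : SolvGroup k) :
    OneForm.pullback (I := 𝓘(ℝ, ℝ × ℝ × ℝ)) 𝓘(ℝ, ℝ × ℝ × ℝ)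
      (fun g : SolvGroup k => g * d) (alphaG k) = alphaG k := by
  funext g
  refine ContinuousLinearMap.ext fun (w : ℝ × ℝ × ℝ) => ?_
  have h := mfderiv_mul_right d g w
  change mvfderiv 𝓘(ℝ, ℝ × ℝ × ℝ) x (g * d) _ -
    (k * (g * d).x) * mvfderiv 𝓘(ℝ, ℝ × ℝ × ℝ) z (g * d) _ =
    mvfderiv 𝓘(ℝ, ℝ × ℝ × ℝ) x g w - (k * g.x) * mvfderiv 𝓘(ℝ, ℝ × ℝ × ℝ) z g w
  erw [h]
  rw [mvfderiv_x, mvfderiv_z, mvfderiv_x, mvfderiv_z, mul_def, x_mk]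
  ring

theorem betaG_rightInvariant (d : SolvGroup k) :
    OneForm.pullback (I := 𝓘(ℝ, ℝ × ℝ × ℝ)) 𝓘(ℝ, ℝ × ℝ × ℝ)
      (fun g : SolvGroup k => g * d) (betaG k) = betaG k := by
  funext g
  refine ContinuousLinearMap.ext fun (w : ℝ × ℝ × ℝ) => ?_
  have h := mfderiv_mul_right d g w
  change mvfderiv 𝓘(ℝ, ℝ × ℝ × ℝ) y (g * d) _ +
    (k * (g * d).y) * mvfderiv 𝓘(ℝ, ℝ × ℝ × ℝ) z (g * d) _ =
    mvfderiv 𝓘(ℝ, ℝ × ℝ × ℝ) y g w + (k * g.y) * mvfderiv 𝓘(ℝ, ℝ × ℝ × ℝ) z g w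
  erw [h]
  rw [mvfderiv_y, mvfderiv_z, mvfderiv_y, mvfderiv_z, mul_def, y_mk]
  ring

theorem gammaG_rightInvariant (d : SolvGroup k) :
    OneForm.pullback (I := 𝓘(ℝ, ℝ × ℝ × ℝ)) 𝓘(ℝ, ℝ × ℝ × ℝ)
      (fun g : SolvGroup k => g * d) (gammaG k) = gammaG k := by
  funext g
  refine ContinuousLinearMap.ext fun (w : ℝ × ℝ × ℝ) => ?_
  have h := mfderiv_mul_right d g w
  change mvfderiv 𝓘(ℝ, ℝ × ℝ × ℝ) z (g * d) _ = mvfderiv 𝓘(ℝ, ℝ × ℝ × ℝ) z g w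
  erw [h]
  rw [mvfderiv_z, mvfderiv_z]

end Quotient

end SolvGroup

/-! ### Calculus of 1-forms, vector fields and brackets on a manifold. -/

section FormCalculus

variable {E : Type*} [NormedAddCommGroup E] [NormedSpace ℝ E] {H : Type*} [TopologicalSpace H]
  {I : ModelWithCorners ℝ E H} {M : Type*} [TopologicalSpace M] [ChartedSpace H M]

/-! Put c = nλ. The forms α, β, γ, η are a coframe on M with dα = -k α∧γ, dβ = k β∧γ, dγ = 0, dη = c
α∧β, and these equations give dΩ = kγ∧Ω for Ω in the first family. With θ = i_XΩ, Cartan's formula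
turns L_XΩ = fΩ into dθ - kγ∧θ = lΩ, where l = f - kγ(X). The twisted differential d - kγ∧ squares
to zero and kills Ω, so dl∧Ω = 0. Since Ω∧Ω is 2(t₁t₂ - ck t₃²) α∧β∧γ∧η, the form Ω is
nondegenerate, and in dimension 4 this forces dl = 0. `frame_annihilates_factor` is this argument in
components, and `IsSolvCoframe.conformalFactor` applies it to X. As M is a circle bundle over a
connected base, l is constant.

It remains to exclude a nonzero constant. Let A and F be the frame fields dual to α and η.
Evaluating lΩ on them gives t₁ l = A(θ(F)) - F(θ(A)). The field F generates the circle action, so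
the second term integrates to zero over each orbit. The field A is invariant, so the orbit integral
of the first term is the derivative along A of the orbit average of θ(F). That average has a maximum
on the compact manifold M, where its derivative vanishes, hence l = 0; this is
`eq_zero_of_sub_eq_const`.

The Lee form is -kγ, unique because Ω is nondegenerate, so it cancels the conformal factor kγ(X).
Exchanging α and β replaces (c, k) by (-c, -k) and carries the second family to the first. -/

theorem IsSmoothOneForm.contMDiff_apply [IsManifold I 1 M] {θ : OneForm I M} {X : VecField I M}
    (hθ : IsSmoothOneForm θ) (hX : IsSmoothVecField X) :
    ContMDiff I 𝓘(ℝ, ℝ) ∞ (fun p => θ p (X p)) := by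
  intro p
  have h := ContMDiffAt.clm_bundle_apply (hθ p) (hX p)
  rw [Bundle.contMDiffAt_section] at h
  exact h

/-- The differential of a function that is smooth near `p` is a 1-form that is smooth near `p`. -/
theorem contMDiffAt_mvfderiv [IsManifold I ∞ M] {f : M → ℝ} {p : M}
    (hf : ContMDiffAt I 𝓘(ℝ, ℝ) ∞ f p) :
    ContMDiffAt I (I.prod 𝓘(ℝ, E →L[ℝ] ℝ)) ∞ (fun p => Bundle.TotalSpace.mk' (E →L[ℝ] ℝ)
    (E := fun p : M => TangentSpace I p →L[ℝ] Bundle.Trivial M ℝ p) p (mvfderiv I f p)) p := by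
  rw [contMDiffAt_hom_bundle]
  refine ⟨contMDiffAt_id, ?_⟩
  have h := hf.mfderiv_const (m := ∞) (by simp)
  convert h using 2
  rename_i q
  ext v
  simp [inTangentCoordinates, ContinuousLinearMap.inCoordinates, mvfderiv]
  rfl

theorem mvfderiv_congr {f g : M → ℝ} {p : M} (h : f =ᶠ[nhds p] g) :
    mvfderiv I f p = mvfderiv I g p := by
  ext v
  have h1 := h.mfderiv_eq (I := I) (I' := 𝓘(ℝ, ℝ))
  exact DFunLike.congr_fun h1 v

theorem mvfderiv_comp_extChartAt [IsManifold I ∞ M] {G : E → ℝ} {p q : M}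
    (hq : q ∈ (extChartAt I p).source) (hG : DifferentiableAt ℝ G (extChartAt I p q))
    (v : TangentSpace I q) :
    mvfderiv I (fun x => G (extChartAt I p x)) q v =
      fderiv ℝ G (extChartAt I p q) (mfderiv I 𝓘(ℝ, E) (extChartAt I p) q v) := by
  have h := mvfderiv_comp_apply (I := 𝓘(ℝ, E)) (I' := I) q hG.mdifferentiableAt
    (mdifferentiableAt_extChartAt (I := I) (x := p) (by rwa [← extChartAt_source (I := I)])) v
  refine h.trans ?_
  rw [mvfderiv, mfderiv_eq_fderiv]
  rfl

/-- In the chart at `p` this reduces to the symmetry of the second derivative. Smoothness of `f` is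
asked only at `p`, since the lemma must apply to the coordinates of a local lift to the group, which
need not be smooth elsewhere. -/
theorem mvfderiv_mlieBracket [I.Boundaryless] [CompleteSpace E] [IsManifold I ∞ M]
    {U V : VecField I M} (hU : IsSmoothVecField U) (hV : IsSmoothVecField V) {f : M → ℝ} {p : M}
    (hf : ContMDiffAt I 𝓘(ℝ, ℝ) ∞ f p) :
    mvfderiv I f p (VectorField.mlieBracket I U V p) =
      mvfderiv I (fun q => mvfderiv I f q (V q)) p (U p) -
        mvfderiv I (fun q => mvfderiv I f q (U q)) p (V p) := by
  set φ := extChartAt I p with hφ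
  set F : E → ℝ := fun x => f (φ.symm x) with hF
  have hr : Set.range I = Set.univ := I.range_eq_univ
  have hps : p ∈ φ.source := mem_extChartAt_source p
  have hFs : ContDiffAt ℝ ∞ F (φ p) := by
    have h := contMDiffWithinAt_extChartAt_symm_range_self (I := I) (n := ∞) p
    rw [hr, contMDiffWithinAt_univ] at h
    exact (hf.comp_of_eq h (extChartAt_to_inv (I := I) p)).contDiffAt
  have hfF : ∀ᶠ q in nhds p, f q = F (φ q) := by
    filter_upwards [extChartAt_source_mem_nhds (I := I) p] with q hq
    rw [hF]
    exact congrArg f (φ.left_inv hq).symm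
  have hFd : ∀ᶠ q in nhds p, DifferentiableAt ℝ F (φ q) :=
    (continuousAt_extChartAt (I := I) p).eventually
      (((hFs.of_le (m := 1) (by simp)).eventually (by simp)).mono fun x hx =>
        hx.differentiableAt (by simp))
  -- The expression of a field in the chart at `p`.
  let hat : VecField I M → E → E := fun W =>
    VectorField.mpullbackWithin 𝓘(ℝ, E) I φ.symm W (Set.range I)
  have hhat : ∀ W : VecField I M, ∀ᶠ q in nhds p,
      (mfderiv I 𝓘(ℝ, E) φ q (W q) : E) = hat W (φ q) := by
    intro W
    have h := VectorField.eventuallyEq_mpullback_mpullbackWithin_extChartAt (I := I) (x := p)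
      (s := Set.univ) W
    rw [nhdsWithin_univ] at h
    filter_upwards [h, extChartAt_source_mem_nhds (I := I) p] with q hq hqs
    have h2 := isInvertible_mfderiv_extChartAt (I := I) hqs
    rw [VectorField.mpullback_apply] at hq
    exact (h2.inverse_apply_eq.1 hq.symm).symm
  have hhatd : ∀ W : VecField I M, IsSmoothVecField W → DifferentiableAt ℝ (hat W) (φ p) := by
    intro W hW
    have h := VectorField.contMDiffWithinAt_mpullbackWithin_extChartAt_symm (I := I) (m := ∞)
      (n := ∞) (hW p).contMDiffWithinAt uniqueMDiffOn_univ (Set.mem_univ p) (by simp)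
    have h2 := (contMDiffWithinAt_vectorSpace_iff_contDiffWithinAt.1 h).contDiffAt
      (Filter.inter_mem (extChartAt_target_mem_nhds (I := I) p) Filter.univ_mem)
    exact h2.differentiableAt (by simp)
  have hG : ∀ W : VecField I M, IsSmoothVecField W →
      DifferentiableAt ℝ (fun x => fderiv ℝ F x (hat W x)) (φ p) := by
    intro W hW
    have h := hFs.fderiv_right (m := 1) (WithTop.coe_le_coe.2 le_top)
    exact (h.differentiableAt (by simp)).clm_apply (hhatd W hW)
  have hfW : ∀ W : VecField I M, ∀ᶠ q in nhds p,
      mvfderiv I f q (W q) = fderiv ℝ F (φ q) (hat W (φ q)) := by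
    intro W
    filter_upwards [hfF.eventually_nhds, hFd, hhat W, extChartAt_source_mem_nhds (I := I) p]
      with q h1 h2 h3 h4
    rw [mvfderiv_congr h1, mvfderiv_comp_extChartAt h4 h2]
    exact congrArg _ h3
  have hgW : ∀ W U : VecField I M, IsSmoothVecField W →
      mvfderiv I (fun q => mvfderiv I f q (W q)) p (U p) =
        fderiv ℝ (fun x => fderiv ℝ F x (hat W x)) (φ p) (hat U (φ p)) := by
    intro W U hW
    have h0 : (fun q => mvfderiv I f q (W q)) =ᶠ[nhds p]
      fun q => (fun x => fderiv ℝ F x (hat W x)) (φ q) := hfW W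
    rw [mvfderiv_congr h0, mvfderiv_comp_extChartAt hps (hG W hW)]
    exact congrArg _ (hhat U).self_of_nhds
  rw [hgW V U hV, hgW U V hU, ← VectorField.fderiv_apply_lieBracket hFs
    (by rw [minSmoothness_of_isRCLikeNormedField]; exact WithTop.coe_le_coe.2 le_top)
    (hhatd V hV) (hhatd U hU), mvfderiv_congr hfF, mvfderiv_comp_extChartAt hps
      hFd.self_of_nhds]
  congr 1
  rw [← VectorField.mlieBracketWithin_univ, VectorField.mlieBracketWithin_apply]
  have h2 := isInvertible_mfderiv_extChartAt (I := I) hps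
  have h3 : VectorField.lieBracketWithin ℝ (hat U) (hat V) (φ.symm ⁻¹' Set.univ ∩ Set.range I)
      (φ p) = VectorField.lieBracket ℝ (hat U) (hat V) (φ p) := by
    rw [hr, Set.preimage_univ, Set.inter_univ, VectorField.lieBracketWithin_univ]
  exact (h2.inverse_apply_eq.1 rfl).symm.trans h3

/-- In a local trivialization the coframe becomes a smooth family `T` of invertible operators, so
the field is the inverse of `T` applied to the constant vector `w`, and operator inversion is
smooth. -/
theorem contMDiff_dualFrame [FiniteDimensional ℝ E] [IsManifold I ∞ M] {n : ℕ}
    {θ : Fin n → OneForm I M} (hθ : ∀ i, IsSmoothOneForm (θ i))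
    (hinj : ∀ p (v : TangentSpace I p), (∀ i, θ i p v = 0) → v = 0)
    (hn : Module.finrank ℝ E = n) {X : VecField I M} {w : Fin n → ℝ}
    (hX : ∀ p i, θ i p (X p) = w i) : IsSmoothVecField X := by
  intro p
  rw [Bundle.contMDiffAt_section]
  let e := trivializationAt E (TangentSpace I) p
  let T : M → E →L[ℝ] Fin n → ℝ := fun q =>
    ContinuousLinearMap.pi fun i => (θ i q).comp (e.symmL ℝ q)
  have hT : ContMDiffAt I 𝓘(ℝ, E →L[ℝ] Fin n → ℝ) ∞ T p := by
    have h : ContMDiffAt I 𝓘(ℝ, Fin n → E →L[ℝ] ℝ) ∞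
        (fun q i => ((θ i q).comp (e.symmL ℝ q) : E →L[ℝ] ℝ)) p := by
      rw [contMDiffAt_pi_space]
      intro i
      have h := ((contMDiffAt_hom_bundle _).1 (hθ i p)).2
      refine h.congr_of_eventuallyEq (Filter.Eventually.of_forall fun q => ?_)
      refine ContinuousLinearMap.ext fun v => ?_
      simp [ContinuousLinearMap.inCoordinates]
      rfl
    have hp : ContDiff ℝ ∞ (fun g : Fin n → E →L[ℝ] ℝ => ContinuousLinearMap.pi g) :=
      (LinearMap.toContinuousLinearMap ({
        toFun := fun g => ContinuousLinearMap.pi g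
        map_add' := fun _ _ => rfl
        map_smul' := fun _ _ => rfl } :
        (Fin n → E →L[ℝ] ℝ) →ₗ[ℝ] E →L[ℝ] Fin n → ℝ)).contDiff
    exact hp.contMDiff.contMDiffAt.comp p h
  have hTi : ∀ q ∈ e.baseSet, (T q).IsInvertible := by
    intro q hq
    have hker : (T q : E →ₗ[ℝ] Fin n → ℝ).ker = ⊥ := by
      rw [LinearMap.ker_eq_bot']
      intro v hv
      have h1 : e.symmL ℝ q v = 0 := hinj q _ fun i => congrFun hv i
      rw [← e.continuousLinearMapAt_symmL (R := ℝ) hq v, h1, map_zero]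
    have hinj' := LinearMap.ker_eq_bot.1 hker
    exact ⟨(LinearEquiv.ofInjectiveOfFinrankEq (T q : E →ₗ[ℝ] Fin n → ℝ) hinj'
      (by simpa using hn)).toContinuousLinearEquiv, rfl⟩
  have hinv : ContMDiffAt I 𝓘(ℝ, E) ∞ (fun q => (T q).inverse w) p := by
    have hpb : p ∈ e.baseSet := FiberBundle.mem_baseSet_trivializationAt' p
    have h1 := (hTi p hpb).contDiffAt_map_inverse (n := ∞)
    exact (h1.contMDiffAt.comp p hT).clm_apply contMDiffAt_const
  refine hinv.congr_of_eventuallyEq ?_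
  filter_upwards [e.open_baseSet.mem_nhds (FiberBundle.mem_baseSet_trivializationAt' p)] with q hq
  symm
  rw [(hTi q hq).inverse_apply_eq]
  funext i
  have h1 : e.symmL ℝ q (e ⟨q, X q⟩).2 = X q := by
    rw [← e.continuousLinearMapAt_apply_of_mem (R := ℝ) hq, e.symmL_continuousLinearMapAt hq]
  exact ((congrArg (θ i q) h1).trans (hX q i)).symm

theorem mvfderiv_const_mul_apply {f : M → ℝ} {p : M} (hf : MDifferentiableAt I 𝓘(ℝ, ℝ) f p) (r : ℝ)
    (w : TangentSpace I p) : mvfderiv I (fun q => r * f q) p w = r * mvfderiv I f p w := by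
  have h := DFunLike.congr_fun (mvfderiv_smul (I := I) (mdifferentiableAt_const (c := r)) hf) w
  rw [mvfderiv_const] at h
  refine h.trans ?_
  simp

end FormCalculus

/-! ### The two families of 2-forms and the symmetry between them. -/

section TwoForms

variable {E : Type*} [NormedAddCommGroup E] [NormedSpace ℝ E] {H : Type*} [TopologicalSpace H]
  {I : ModelWithCorners ℝ E H} {M : Type*} [TopologicalSpace M] [ChartedSpace H M]

theorem omegaT_apply (α β γ η : OneForm I M) (c k t₁ t₂ t₃ : ℝ) (p : M) (u v : TangentSpace I p) :
    omegaT α β γ η c k t₁ t₂ t₃ p ![u, v] =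
      t₁ * (α p u * η p v - α p v * η p u) + t₂ * (β p u * γ p v - β p v * γ p u) +
        t₃ * (c * (α p u * β p v - α p v * β p u) - k * (γ p u * η p v - γ p v * η p u)) := by
  rw [← OneForm.wedge_apply, ← OneForm.wedge_apply, ← OneForm.wedge_apply, ← OneForm.wedge_apply]
  rfl

theorem OneForm.wedge_swap (θ ζ : OneForm I M) : θ.wedge ζ = -ζ.wedge θ := by
  funext p
  ext w
  have hw : w = ![w 0, w 1] := by funext i; fin_cases i <;> rfl
  rw [hw]
  change θ.wedge ζ p ![w 0, w 1] = -(ζ.wedge θ p ![w 0, w 1])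
  rw [OneForm.wedge_apply, OneForm.wedge_apply]
  ring

/-- This sign bookkeeping lets one argument serve both families. -/
theorem omegaS_eq_omegaT (α β γ η : OneForm I M) (c k s₁ s₂ s₃ : ℝ) :
    omegaS α β γ η c k s₁ s₂ s₃ = omegaT β α γ η (-c) (-k) s₁ s₂ s₃ := by
  have h : ∀ (r : ℝ) (Ω : TwoForm I M), (-r) • Ω = -(r • Ω) := fun r Ω =>
    funext fun p => neg_smul r (Ω p)
  rw [omegaS, omegaT, OneForm.wedge_swap α β, smul_neg, h c, h k, sub_neg_eq_add]

end TwoForms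

/-! ### The square of the twisted differential in a frame. -/

section StructureEquations

/-- The equations for the values `a`, `b`, `z`, `e` of a twisted primitive of `l Ω` on a frame with
the structure equations below force `l` to be annihilated by the frame. -/
theorem frame_annihilates_factor {V : Type*} [AddCommGroup V] [Module ℝ V] {A B C F : V →ₗ[ℝ] V}
    {c k t₁ t₂ t₃ : ℝ} (hd : t₁ * t₂ ≠ c * k * t₃ ^ 2)
    (hAB : ∀ h, A (B h) - B (A h) = -(c • F h)) (hAC : ∀ h, A (C h) - C (A h) = k • A h)
    (hBC : ∀ h, B (C h) - C (B h) = -(k • B h)) (hAF : ∀ h, A (F h) - F (A h) = 0)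
    (hBF : ∀ h, B (F h) - F (B h) = 0) (hCF : ∀ h, C (F h) - F (C h) = 0)
    {a b z e l : V} (eAB : A b - B a + c • e = (t₃ * c) • l) (eAC : A z - C a = 0)
    (eBC : B z - C b + (2 * k) • b = t₂ • l) (eAF : A e - F a = t₁ • l) (eBF : B e - F b = 0)
    (eCF : C e - F z - k • e = -((k * t₃) • l)) : A l = 0 ∧ B l = 0 ∧ C l = 0 ∧ F l = 0 := by
  -- The next four identities are the components of dl∧Ω = 0. In each, the equations for the three
  -- pairs from a triple of frame fields are differentiated along the remaining field and combined
  -- with alternating signs; the commutators then remove all second derivatives.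
  have hABF : t₁ • B l = (t₃ * c) • F l := by
    have h1 := congrArg A eBF
    have h2 := congrArg B eAF
    have h3 := congrArg F eAB
    simp only [map_sub, map_add, map_smul, map_zero] at h1 h2 h3
    linear_combination (norm := module) h1 - h2 + h3 - hAB e + hAF b - hBF a
  have hABC : t₂ • A l + (t₃ * c) • C l = 0 := by
    have h1 := congrArg A eBC
    have h2 := congrArg B eAC
    have h3 := congrArg C eAB
    simp only [map_sub, map_add, map_smul, map_zero] at h1 h2 h3
    linear_combination (norm := module) -h1 + h2 - h3 + hAB z - hAC b + hBC a + c • eCF + k • eAB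
  have hACF : t₁ • C l + (k * t₃) • A l = 0 := by
    have h1 := congrArg A eCF
    have h2 := congrArg C eAF
    have h3 := congrArg F eAC
    simp only [map_sub, map_neg, map_smul, map_zero] at h1 h2 h3
    linear_combination (norm := module) h1 - h2 + h3 - hAC e + hAF z - hCF a
  have hBCF : t₂ • F l = (k * t₃) • B l := by
    have h1 := congrArg B eCF
    have h2 := congrArg C eBF
    have h3 := congrArg F eBC
    simp only [map_sub, map_add, map_neg, map_smul, map_zero] at h1 h2 h3
    linear_combination (norm := module) -h1 + h2 - h3 + hBC e - hBF z + hCF b - (2 * k) • eBF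
  -- The four identities split into a 2×2 system for `A l`, `C l` and one for `B l`, `F l`. Each has
  -- this number, the Pfaffian of Ω, as determinant up to sign.
  have hne : t₁ * t₂ - c * k * t₃ ^ 2 ≠ 0 := sub_ne_zero.2 hd
  have key : ∀ v : V, (t₁ * t₂ - c * k * t₃ ^ 2) • v = 0 → v = 0 := fun v hv =>
    (smul_eq_zero.1 hv).resolve_left hne
  refine ⟨key _ ?_, key _ ?_, key _ ?_, key _ ?_⟩
  · linear_combination (norm := module) t₁ • hABC - (t₃ * c) • hACF
  · linear_combination (norm := module) t₂ • hABF + (t₃ * c) • hBCF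
  · linear_combination (norm := module) t₂ • hACF - (k * t₃) • hABC
  · linear_combination (norm := module) t₁ • hBCF + (k * t₃) • hABF

end StructureEquations

/-! ### Coframes with the structure equations, and the conformal factor. -/

section Coframe

variable {E : Type*} [NormedAddCommGroup E] [NormedSpace ℝ E] {H : Type*} [TopologicalSpace H]
  {I : ModelWithCorners ℝ E H} {M : Type*} [TopologicalSpace M] [ChartedSpace H M]

theorem contMDiff_mvfderiv_apply [IsManifold I ∞ M] {U : VecField I M} (hU : IsSmoothVecField U)
    {f : M → ℝ} (hf : ContMDiff I 𝓘(ℝ, ℝ) ∞ f) :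
    ContMDiff I 𝓘(ℝ, ℝ) ∞ (fun p => mvfderiv I f p (U p)) :=
  IsSmoothOneForm.contMDiff_apply (fun p => contMDiffAt_mvfderiv (hf p)) hU

theorem mvfderiv_eq_zero_of_forall_eq {f : M → ℝ} {r : ℝ} (hf : ∀ p, f p = r) (p : M) :
    mvfderiv I f p = 0 := by
  rw [funext hf]
  exact mvfderiv_const r

theorem smul_wedge_apply (r : ℝ) (θ ζ : OneForm I M) (p : M) (u v : TangentSpace I p) :
    (r • θ.wedge ζ) p ![u, v] = r * (θ p u * ζ p v - θ p v * ζ p u) := by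
  rw [← OneForm.wedge_apply]
  rfl

/-- The derivative of smooth functions along a smooth vector field. -/
noncomputable def dirDeriv [IsManifold I ∞ M] {U : VecField I M} (hU : IsSmoothVecField U) :
    C^∞⟮I, M; 𝓘(ℝ, ℝ), ℝ⟯ →ₗ[ℝ] C^∞⟮I, M; 𝓘(ℝ, ℝ), ℝ⟯ where
  toFun f := ⟨fun p => mvfderiv I f p (U p), contMDiff_mvfderiv_apply hU f.contMDiff⟩
  map_add' f g := by
    ext p
    have h := mvfderiv_add (I := I) (f.contMDiff.mdifferentiableAt (x := p) (by simp))
      (g.contMDiff.mdifferentiableAt (x := p) (by simp))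
    exact DFunLike.congr_fun h (U p)
  map_smul' r f := by
    ext p
    have h := mvfderiv_smul (I := I) (mdifferentiableAt_const (c := r) (x := p))
      (f.contMDiff.mdifferentiableAt (x := p) (by simp))
    have h' := DFunLike.congr_fun h (U p)
    refine h'.trans ?_
    have h0 := mvfderiv_const (I := I) (M := M) r (x := p)
    change r * _ + (mvfderiv I (fun _ => r) p) (U p) * f p = r * _
    rw [h0]
    simp

theorem dirDeriv_comm [I.Boundaryless] [CompleteSpace E] [IsManifold I ∞ M]
    {U V : VecField I M} (hU : IsSmoothVecField U) (hV : IsSmoothVecField V)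
    (f : C^∞⟮I, M; 𝓘(ℝ, ℝ), ℝ⟯) (p : M) :
    (dirDeriv hU (dirDeriv hV f) - dirDeriv hV (dirDeriv hU f)) p =
      mvfderiv I f p (VectorField.mlieBracket I U V p) :=
  (mvfderiv_mlieBracket hU hV (f.contMDiff p)).symm

/-- A smooth global coframe with the structure equations `dα = -k α ∧ γ`, `dβ = k β ∧ γ`, `dγ = 0`,
`dη = c α ∧ β`. -/
structure IsSolvCoframe [IsManifold I 1 M] (α β γ η : OneForm I M) (c k : ℝ) : Prop where
  smooth_α : IsSmoothOneForm α
  smooth_β : IsSmoothOneForm β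
  smooth_γ : IsSmoothOneForm γ
  smooth_η : IsSmoothOneForm η
  extDeriv_α : IsExtDeriv α (-k • α.wedge γ)
  extDeriv_β : IsExtDeriv β (k • β.wedge γ)
  extDeriv_γ : IsExtDeriv γ 0
  extDeriv_η : IsExtDeriv η (c • α.wedge β)
  injective : ∀ (p : M) (v : TangentSpace I p),
    α p v = 0 → β p v = 0 → γ p v = 0 → η p v = 0 → v = 0

/-- The product of the two constants is unchanged, and so is the nondegeneracy condition. -/
theorem IsSolvCoframe.swap [IsManifold I 1 M] {α β γ η : OneForm I M} {c k : ℝ}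
    (h : IsSolvCoframe α β γ η c k) : IsSolvCoframe β α γ η (-c) (-k) where
  smooth_α := h.smooth_β
  smooth_β := h.smooth_α
  smooth_γ := h.smooth_γ
  smooth_η := h.smooth_η
  extDeriv_α := by rw [neg_neg]; exact h.extDeriv_β
  extDeriv_β := h.extDeriv_α
  extDeriv_γ := h.extDeriv_γ
  extDeriv_η := by
    have e : -c • β.wedge α = c • α.wedge β := by
      rw [OneForm.wedge_swap α β]
      exact funext fun p => (neg_smul c (β.wedge α p)).trans (smul_neg c _).symm
    rw [e]
    exact h.extDeriv_η
  injective p v h1 h2 := h.injective p v h2 h1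

/-- The smooth vector field `X` has constant values `a`, `b`, `z`, `e` under four 1-forms. -/
structure IsFrameField [IsManifold I 1 M] (α β γ η : OneForm I M) (X : VecField I M)
    (a b z e : ℝ) : Prop where
  smooth : IsSmoothVecField X
  α_eq : ∀ p, α p (X p) = a
  β_eq : ∀ p, β p (X p) = b
  γ_eq : ∀ p, γ p (X p) = z
  η_eq : ∀ p, η p (X p) = e

theorem IsSolvCoframe.exists_frameField [FiniteDimensional ℝ E] (hE : Module.finrank ℝ E = 4)
    [IsManifold I ∞ M] {α β γ η : OneForm I M} {c k : ℝ} (h : IsSolvCoframe α β γ η c k)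
    (a b z e : ℝ) : ∃ X : VecField I M, IsFrameField α β γ η X a b z e := by
  have hex : ∀ p : M, ∃ v : TangentSpace I p, α p v = a ∧ β p v = b ∧ γ p v = z ∧ η p v = e := by
    intro p
    let T : E →ₗ[ℝ] Fin 4 → ℝ := LinearMap.pi
      ![(α p : E →L[ℝ] ℝ).toLinearMap, (β p : E →L[ℝ] ℝ).toLinearMap, (γ p : E →L[ℝ] ℝ).toLinearMap,
        (η p : E →L[ℝ] ℝ).toLinearMap]
    have hT : Function.Injective T := by
      rw [← LinearMap.ker_eq_bot, LinearMap.ker_eq_bot']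
      intro v hv
      exact h.injective p v (congrFun hv 0) (congrFun hv 1) (congrFun hv 2) (congrFun hv 3)
    obtain ⟨v, hv⟩ := (LinearMap.injective_iff_surjective_of_finrank_eq_finrank
      (by rw [hE, Module.finrank_fin_fun])).1 hT ![a, b, z, e]
    exact ⟨v, congrFun hv 0, congrFun hv 1, congrFun hv 2, congrFun hv 3⟩
  choose X hX using hex
  refine ⟨X, ?_, fun p => (hX p).1, fun p => (hX p).2.1, fun p => (hX p).2.2.1,
    fun p => (hX p).2.2.2⟩
  refine contMDiff_dualFrame (θ := ![α, β, γ, η]) (w := ![a, b, z, e]) ?_ ?_ hE ?_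
  · intro i
    fin_cases i
    exacts [h.smooth_α, h.smooth_β, h.smooth_γ, h.smooth_η]
  · intro p v hv
    exact h.injective p v (hv 0) (hv 1) (hv 2) (hv 3)
  · intro p i
    fin_cases i
    exacts [(hX p).1, (hX p).2.1, (hX p).2.2.1, (hX p).2.2.2]

variable [IsManifold I ∞ M] {α β γ η : OneForm I M} {c k : ℝ}

/-- The value of a 1-form on the bracket with a vector field on which the form is constant. -/
theorem IsExtDeriv.apply_mlieBracket {θ : OneForm I M} {Θ : TwoForm I M} (h : IsExtDeriv θ Θ)
    {X U : VecField I M} (hX : IsSmoothVecField X) (hU : IsSmoothVecField U) {r : ℝ}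
    (hr : ∀ p, θ p (U p) = r) (p : M) :
    θ p (VectorField.mlieBracket I X U p) =
      -mvfderiv I (fun q => θ q (X q)) p (U p) - Θ p ![X p, U p] := by
  rw [h X U hX hU p, mvfderiv_eq_zero_of_forall_eq hr p]
  simp

section FrameBracket

variable {X U : VecField I M} {a b z e : ℝ}

theorem IsSolvCoframe.α_mlieBracket (h : IsSolvCoframe α β γ η c k) (hX : IsSmoothVecField X)
    (hU : IsFrameField α β γ η U a b z e) (p : M) :
    α p (VectorField.mlieBracket I X U p) =
      -mvfderiv I (fun q => α q (X q)) p (U p) + k * (α p (X p) * z - a * γ p (X p)) := by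
  rw [h.extDeriv_α.apply_mlieBracket hX hU.smooth hU.α_eq, smul_wedge_apply, hU.α_eq, hU.γ_eq]
  ring

theorem IsSolvCoframe.β_mlieBracket (h : IsSolvCoframe α β γ η c k) (hX : IsSmoothVecField X)
    (hU : IsFrameField α β γ η U a b z e) (p : M) :
    β p (VectorField.mlieBracket I X U p) =
      -mvfderiv I (fun q => β q (X q)) p (U p) - k * (β p (X p) * z - b * γ p (X p)) := by
  rw [h.extDeriv_β.apply_mlieBracket hX hU.smooth hU.β_eq, smul_wedge_apply, hU.β_eq, hU.γ_eq]

theorem IsSolvCoframe.γ_mlieBracket (h : IsSolvCoframe α β γ η c k) (hX : IsSmoothVecField X)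
    (hU : IsFrameField α β γ η U a b z e) (p : M) :
    γ p (VectorField.mlieBracket I X U p) = -mvfderiv I (fun q => γ q (X q)) p (U p) := by
  rw [h.extDeriv_γ.apply_mlieBracket hX hU.smooth hU.γ_eq]
  exact sub_zero _

theorem IsSolvCoframe.η_mlieBracket (h : IsSolvCoframe α β γ η c k) (hX : IsSmoothVecField X)
    (hU : IsFrameField α β γ η U a b z e) (p : M) :
    η p (VectorField.mlieBracket I X U p) =
      -mvfderiv I (fun q => η q (X q)) p (U p) - c * (α p (X p) * b - a * β p (X p)) := by
  rw [h.extDeriv_η.apply_mlieBracket hX hU.smooth hU.η_eq, smul_wedge_apply, hU.α_eq, hU.β_eq]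

theorem IsSolvCoframe.ext_vector (h : IsSolvCoframe α β γ η c k) {p : M} {v w : TangentSpace I p}
    (hα : α p v = α p w) (hβ : β p v = β p w) (hγ : γ p v = γ p w) (hη : η p v = η p w) :
    v = w := by
  refine sub_eq_zero.1 (h.injective p _ ?_ ?_ ?_ ?_) <;> rw [map_sub, sub_eq_zero] <;> assumption

/-- The bracket of two fields of constant coefficients. -/
theorem IsSolvCoframe.mlieBracket_eq (h : IsSolvCoframe α β γ η c k) {V W : VecField I M}
    {a' b' z' e' a'' b'' z'' e'' : ℝ} (hU : IsFrameField α β γ η U a b z e)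
    (hV : IsFrameField α β γ η V a' b' z' e') (hW : IsFrameField α β γ η W a'' b'' z'' e'') {r : ℝ}
    (h1 : k * (a * z' - a' * z) = r * a'') (h2 : -(k * (b * z' - b' * z)) = r * b'')
    (h3 : 0 = r * z'') (h4 : -(c * (a * b' - a' * b)) = r * e'') (p : M) :
    VectorField.mlieBracket I U V p = r • W p := by
  have e1 := mvfderiv_eq_zero_of_forall_eq (I := I) hU.α_eq p
  have e2 := mvfderiv_eq_zero_of_forall_eq (I := I) hU.β_eq p
  have e3 := mvfderiv_eq_zero_of_forall_eq (I := I) hU.γ_eq p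
  have e4 := mvfderiv_eq_zero_of_forall_eq (I := I) hU.η_eq p
  apply h.ext_vector
  · rw [h.α_mlieBracket hU.smooth hV, e1, map_smul, hW.α_eq, hU.α_eq, hU.γ_eq, smul_eq_mul, ← h1]
    simp
  · rw [h.β_mlieBracket hU.smooth hV, e2, map_smul, hW.β_eq, hU.β_eq, hU.γ_eq, smul_eq_mul, ← h2]
    simp
  · rw [h.γ_mlieBracket hU.smooth hV, e3, map_smul, hW.γ_eq, smul_eq_mul, ← h3]
    simp
  · rw [h.η_mlieBracket hU.smooth hV, e4, map_smul, hW.η_eq, hU.α_eq, hU.β_eq, smul_eq_mul, ← h4]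
    simp

theorem IsSolvCoframe.dirDeriv_comm [I.Boundaryless] [CompleteSpace E]
    (h : IsSolvCoframe α β γ η c k) {V W : VecField I M}
    {a' b' z' e' a'' b'' z'' e'' : ℝ} (hU : IsFrameField α β γ η U a b z e)
    (hV : IsFrameField α β γ η V a' b' z' e') (hW : IsFrameField α β γ η W a'' b'' z'' e'') {r : ℝ}
    (h1 : k * (a * z' - a' * z) = r * a'') (h2 : -(k * (b * z' - b' * z)) = r * b'')
    (h3 : 0 = r * z'') (h4 : -(c * (a * b' - a' * b)) = r * e'')
    (f : C^∞⟮I, M; 𝓘(ℝ, ℝ), ℝ⟯) :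
    dirDeriv hU.smooth (dirDeriv hV.smooth f) - dirDeriv hV.smooth (dirDeriv hU.smooth f) =
      r • dirDeriv hW.smooth f := by
  ext p
  rw [_root_.dirDeriv_comm, h.mlieBracket_eq hU hV hW h1 h2 h3 h4 p, map_smul]
  rfl

end FrameBracket

/-- The conformal factor of an infinitesimal automorphism differs from `k γ(X)` by a locally constant
function, a multiple of which is the difference of two directional derivatives. -/
theorem IsSolvCoframe.conformalFactor [I.Boundaryless] [CompleteSpace E]
    (h : IsSolvCoframe α β γ η c k) {A B C F : VecField I M}
    (hA : IsFrameField α β γ η A 1 0 0 0) (hB : IsFrameField α β γ η B 0 1 0 0)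
    (hC : IsFrameField α β γ η C 0 0 1 0) (hF : IsFrameField α β γ η F 0 0 0 1)
    {t₁ t₂ t₃ : ℝ} (h12 : t₁ * t₂ ≠ 0) (hd : t₁ * t₂ ≠ c * k * t₃ ^ 2)
    {X : VecField I M} (hX : IsSmoothVecField X) {f : M → ℝ}
    (hf : IsConformalAlong X (omegaT α β γ η c k t₁ t₂ t₃) f) :
    ∃ l u v : C^∞⟮I, M; 𝓘(ℝ, ℝ), ℝ⟯, (∀ p, f p = k * γ p (X p) + l p) ∧
      (∀ p, mvfderiv I l p = 0) ∧
      (∀ p, mvfderiv I u p (A p) - mvfderiv I v p (F p) = t₁ * l p) := by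
  have ht1 : t₁ ≠ 0 := left_ne_zero_of_mul h12
  let a : C^∞⟮I, M; 𝓘(ℝ, ℝ), ℝ⟯ := ⟨_, h.smooth_α.contMDiff_apply hX⟩
  let b : C^∞⟮I, M; 𝓘(ℝ, ℝ), ℝ⟯ := ⟨_, h.smooth_β.contMDiff_apply hX⟩
  let z : C^∞⟮I, M; 𝓘(ℝ, ℝ), ℝ⟯ := ⟨_, h.smooth_γ.contMDiff_apply hX⟩
  let e : C^∞⟮I, M; 𝓘(ℝ, ℝ), ℝ⟯ := ⟨_, h.smooth_η.contMDiff_apply hX⟩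
  -- The values of the contraction i_XΩ on `A`, `B`, `C`, `F`.
  let θa := -(t₁ • e) - (t₃ * c) • b
  let θb := -(t₂ • z) + (t₃ * c) • a
  let θc := t₂ • b + (t₃ * k) • e
  let θe := t₁ • a - (t₃ * k) • z
  -- The factor `f` is not known to be smooth. Solving the (A, F) component of the twisted equation
  -- for `l` defines it as a smooth function from the outset.
  let l := t₁⁻¹ • (dirDeriv hA.smooth θe - dirDeriv hF.smooth θa)
  -- Ω is constant on a pair of frame fields, so the derivative along `X` drops out of the Lie
  -- derivative.
  have key : ∀ {U V : VecField I M} {a₁ b₁ z₁ e₁ a₂ b₂ z₂ e₂ : ℝ}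
      (hU : IsFrameField α β γ η U a₁ b₁ z₁ e₁) (hV : IsFrameField α β γ η V a₂ b₂ z₂ e₂) (p : M),
      f p * omegaT α β γ η c k t₁ t₂ t₃ p ![U p, V p] =
        - omegaT α β γ η c k t₁ t₂ t₃ p ![VectorField.mlieBracket I X U p, V p]
        - omegaT α β γ η c k t₁ t₂ t₃ p ![U p, VectorField.mlieBracket I X V p] := by
    intro U V a₁ b₁ z₁ e₁ a₂ b₂ z₂ e₂ hU hV p
    have h1 := hf U V hU.smooth hV.smooth p
    have h2 : ∀ q, omegaT α β γ η c k t₁ t₂ t₃ q ![U q, V q] = t₁ * (a₁ * e₂ - a₂ * e₁) +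
        t₂ * (b₁ * z₂ - b₂ * z₁) + t₃ * (c * (a₁ * b₂ - a₂ * b₁) - k * (z₁ * e₂ - z₂ * e₁)) := by
      intro q
      rw [omegaT_apply, hU.α_eq, hU.β_eq, hU.γ_eq, hU.η_eq, hV.α_eq, hV.β_eq, hV.γ_eq, hV.η_eq]
    rw [mvfderiv_eq_zero_of_forall_eq h2] at h1
    refine Eq.trans h1 ?_
    simp
  have hAB := fun p => key hA hB p
  have hAC := fun p => key hA hC p
  have hAF := fun p => key hA hF p
  have hBC := fun p => key hB hC p
  have hBF := fun p => key hB hF p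
  have hCF := fun p => key hC hF p
  simp only [omegaT_apply, h.α_mlieBracket hX hA, h.β_mlieBracket hX hA, h.γ_mlieBracket hX hA,
    h.η_mlieBracket hX hA, h.α_mlieBracket hX hB, h.β_mlieBracket hX hB, h.γ_mlieBracket hX hB,
    h.η_mlieBracket hX hB, h.α_mlieBracket hX hC, h.β_mlieBracket hX hC, h.γ_mlieBracket hX hC,
    h.η_mlieBracket hX hC, h.α_mlieBracket hX hF, h.β_mlieBracket hX hF, h.γ_mlieBracket hX hF,
    h.η_mlieBracket hX hF, hA.α_eq, hA.β_eq, hA.γ_eq, hA.η_eq, hB.α_eq, hB.β_eq, hB.γ_eq, hB.η_eq,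
    hC.α_eq, hC.β_eq, hC.γ_eq, hC.η_eq, hF.α_eq, hF.β_eq, hF.γ_eq, hF.η_eq]
    at hAB hAC hAF hBC hBF hCF
  have hfl : ∀ p, f p = k * γ p (X p) + l p := by
    intro p
    have h1 : l p = t₁⁻¹ * (dirDeriv hA.smooth θe p - dirDeriv hF.smooth θa p) := rfl
    simp only [θe, θa, map_sub, map_neg, map_smul] at h1
    change l p = t₁⁻¹ * ((t₁ * mvfderiv I (fun q => α q (X q)) p (A p)
      - (t₃ * k) * mvfderiv I (fun q => γ q (X q)) p (A p)) -
      (-(t₁ * mvfderiv I (fun q => η q (X q)) p (F p)) -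
        (t₃ * c) * mvfderiv I (fun q => β q (X q)) p (F p))) at h1
    rw [h1]
    field_simp
    linear_combination hAF p
  have D : ∀ {U : VecField I M} (hU : IsSmoothVecField U) (p : M),
      dirDeriv hU θa p = -(t₁ * mvfderiv I (fun q => η q (X q)) p (U p)) -
        (t₃ * c) * mvfderiv I (fun q => β q (X q)) p (U p) ∧
      dirDeriv hU θb p = -(t₂ * mvfderiv I (fun q => γ q (X q)) p (U p)) +
        (t₃ * c) * mvfderiv I (fun q => α q (X q)) p (U p) ∧
      dirDeriv hU θc p = t₂ * mvfderiv I (fun q => β q (X q)) p (U p) +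
        (t₃ * k) * mvfderiv I (fun q => η q (X q)) p (U p) ∧
      dirDeriv hU θe p = t₁ * mvfderiv I (fun q => α q (X q)) p (U p) -
        (t₃ * k) * mvfderiv I (fun q => γ q (X q)) p (U p) := by
    intro U hU p
    simp only [θa, θb, θc, θe, map_sub, map_add, map_neg, map_smul]
    exact ⟨rfl, rfl, rfl, rfl⟩
  -- The commutators are [A, B] = -cF, [A, C] = kA, [B, C] = -kB, and F commutes with the frame. The
  -- six equations after them are dθ - kγ∧θ = lΩ on pairs of frame fields, with θ = i_XΩ.
  have hl0 := frame_annihilates_factor (A := dirDeriv hA.smooth) (B := dirDeriv hB.smooth)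
    (C := dirDeriv hC.smooth) (F := dirDeriv hF.smooth) hd
    (a := θa) (b := θb) (z := θc) (e := θe) (l := l)
    (fun g => (h.dirDeriv_comm hA hB hF (r := -c) (by ring) (by ring) (by ring) (by ring) g).trans
      (neg_smul c _))
    (fun g => h.dirDeriv_comm hA hC hA (by ring) (by ring) (by ring) (by ring) g)
    (fun g => (h.dirDeriv_comm hB hC hB (r := -k) (by ring) (by ring) (by ring) (by ring) g).trans
      (neg_smul k _))
    (fun g => (h.dirDeriv_comm hA hF hF (r := 0) (by ring) (by ring) (by ring) (by ring) g).trans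
      (zero_smul ℝ _))
    (fun g => (h.dirDeriv_comm hB hF hF (r := 0) (by ring) (by ring) (by ring) (by ring) g).trans
      (zero_smul ℝ _))
    (fun g => (h.dirDeriv_comm hC hF hF (r := 0) (by ring) (by ring) (by ring) (by ring) g).trans
      (zero_smul ℝ _))
    (by
      ext p
      change dirDeriv hA.smooth θb p - dirDeriv hB.smooth θa p +
        c * (t₁ * α p (X p) - (t₃ * k) * γ p (X p)) = (t₃ * c) * l p
      rw [(D hA.smooth p).2.1, (D hB.smooth p).1]
      linear_combination (t₃ * c) * hfl p - hAB p)
    (by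
      ext p
      change dirDeriv hA.smooth θc p - dirDeriv hC.smooth θa p = 0
      rw [(D hA.smooth p).2.2.1, (D hC.smooth p).1]
      linear_combination -hAC p)
    (by
      ext p
      change dirDeriv hB.smooth θc p - dirDeriv hC.smooth θb p +
        (2 * k) * (-(t₂ * γ p (X p)) + (t₃ * c) * α p (X p)) = t₂ * l p
      rw [(D hB.smooth p).2.2.1, (D hC.smooth p).2.1]
      linear_combination t₂ * hfl p - hBC p)
    (by
      ext p
      change dirDeriv hA.smooth θe p - dirDeriv hF.smooth θa p = t₁ * l p
      rw [(D hA.smooth p).2.2.2, (D hF.smooth p).1]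
      linear_combination t₁ * hfl p - hAF p)
    (by
      ext p
      change dirDeriv hB.smooth θe p - dirDeriv hF.smooth θb p = 0
      rw [(D hB.smooth p).2.2.2, (D hF.smooth p).2.1]
      linear_combination -hBF p)
    (by
      ext p
      change dirDeriv hC.smooth θe p - dirDeriv hF.smooth θc p -
        k * (t₁ * α p (X p) - (t₃ * k) * γ p (X p)) = -((k * t₃) * l p)
      rw [(D hC.smooth p).2.2.2, (D hF.smooth p).2.2.1]
      linear_combination -(k * t₃) * hfl p - hCF p)
  obtain ⟨lA, lB, lC, lF⟩ := hl0
  refine ⟨l, θe, θa, hfl, fun p => ?_, fun p => ?_⟩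
  · ext v
    have hv : v = α p v • A p + β p v • B p + γ p v • C p + η p v • F p := by
      apply h.ext_vector <;>
      simp [hA.α_eq, hA.β_eq, hA.γ_eq, hA.η_eq, hB.α_eq, hB.β_eq, hB.γ_eq, hB.η_eq,
        hC.α_eq, hC.β_eq, hC.γ_eq, hC.η_eq, hF.α_eq, hF.β_eq, hF.γ_eq, hF.η_eq]
    have l1 : mvfderiv I l p (A p) = 0 := DFunLike.congr_fun lA p
    have l2 : mvfderiv I l p (B p) = 0 := DFunLike.congr_fun lB p
    have l3 : mvfderiv I l p (C p) = 0 := DFunLike.congr_fun lC p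
    have l4 : mvfderiv I l p (F p) = 0 := DFunLike.congr_fun lF p
    rw [hv]
    simp only [map_add, map_smul, l1, l2, l3, l4]
    simp
  · have h1 : l p = t₁⁻¹ * (mvfderiv I θe p (A p) - mvfderiv I θa p (F p)) := rfl
    rw [h1, mul_inv_cancel_left₀ ht1]

end Coframe

/-! ### Averages over the orbits of a circle action. -/

section CircleAverage

/-- The partial derivative is continuous, hence bounded on a compact rectangle around the segment
over `s₀`, and a constant dominates it there. -/
theorem hasDerivAt_intervalIntegral_of_contDiff {g : ℝ × ℝ → ℝ} (hg : ContDiff ℝ 1 g) (s₀ : ℝ) :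
    HasDerivAt (fun s => ∫ t in (0 : ℝ)..1, g (s, t))
      (∫ t in (0 : ℝ)..1, fderiv ℝ g (s₀, t) (1, 0)) s₀ := by
  have hg' : Continuous fun q : ℝ × ℝ => fderiv ℝ g q (1, 0) :=
    (hg.continuous_fderiv one_ne_zero).clm_apply continuous_const
  obtain ⟨K, hK⟩ := ((isCompact_Icc (a := s₀ - 1) (b := s₀ + 1)).prod
    (isCompact_Icc (a := (0 : ℝ)) (b := 1))).exists_bound_of_continuousOn hg'.continuousOn
  refine (intervalIntegral.hasDerivAt_integral_of_dominated_loc_of_deriv_le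
    (F := fun s t => g (s, t)) (F' := fun s t => fderiv ℝ g (s, t) (1, 0)) (bound := fun _ => K)
    (Icc_mem_nhds (a := s₀ - 1) (b := s₀ + 1) (by linarith) (by linarith)) ?_ ?_ ?_ ?_ ?_ ?_).2
  · exact Filter.Eventually.of_forall fun s =>
      (hg.continuous.comp (Continuous.prodMk_right s)).aestronglyMeasurable
  · exact (hg.continuous.comp (Continuous.prodMk_right s₀)).intervalIntegrable _ _
  · exact (hg'.comp (Continuous.prodMk_right s₀)).aestronglyMeasurable
  · refine Filter.Eventually.of_forall fun t ht s hs => hK _ ⟨hs, ?_⟩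
    rw [Set.uIoc_of_le zero_le_one] at ht
    exact Set.Ioc_subset_Icc_self ht
  · exact intervalIntegrable_const
  · refine Filter.Eventually.of_forall fun t _ s _ => ?_
    have h1 : HasDerivAt (fun s : ℝ => (s, t)) ((1 : ℝ), (0 : ℝ)) s :=
      (hasDerivAt_id s).prodMk (hasDerivAt_const s t)
    exact ((hg.differentiable one_ne_zero (s, t)).hasFDerivAt).comp_hasDerivAt s h1

variable {E : Type*} [NormedAddCommGroup E] [NormedSpace ℝ E] {H : Type*} [TopologicalSpace H]
  {I : ModelWithCorners ℝ E H} {M : Type*} [TopologicalSpace M] [ChartedSpace H M]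

/-- Through every tangent vector passes, up to a positive factor, a smooth curve defined on `ℝ`. -/
theorem exists_curve [I.Boundaryless] [IsManifold I ∞ M] {p : M} (v : TangentSpace I p) :
    ∃ (σ : ℝ → M) (ε : ℝ), 0 < ε ∧ ContMDiff 𝓘(ℝ, ℝ) I ∞ σ ∧ σ 0 = p ∧
      ∀ f : M → ℝ, ContMDiff I 𝓘(ℝ, ℝ) ∞ f →
        HasDerivAt (fun s => f (σ s)) (ε * mvfderiv I f p v) 0 := by
  set φ := extChartAt I p with hφ
  set w : E := mfderiv I 𝓘(ℝ, E) φ p v with hw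
  have hc : Filter.Tendsto (fun r : ℝ => φ p + r • w) (nhds 0) (nhds (φ p)) := by
    have : Continuous fun r : ℝ => φ p + r • w := by fun_prop
    simpa using this.tendsto 0
  obtain ⟨ε, hε, hball⟩ := Metric.eventually_nhds_iff_ball.1
    (hc.eventually (extChartAt_target_mem_nhds (I := I) p))
  -- The bounded sine keeps the segment inside the chart for every real `s`, so the curve is smooth
  -- on the whole line; its velocity at 0 is `w` scaled by ε/2.
  let c : ℝ → E := fun s => φ p + (ε / 2 * Real.sin s) • w
  have hct : ∀ s, c s ∈ φ.target := by
    intro s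
    apply hball
    rw [Metric.mem_ball, dist_zero_right, norm_mul, Real.norm_eq_abs, Real.norm_eq_abs,
      abs_of_pos (half_pos hε)]
    nlinarith [Real.abs_sin_le_one s]
  have hcs : ContDiff ℝ ∞ c := by fun_prop
  have hc0 : c 0 = φ p := by simp [c]
  have hcd : HasDerivAt c ((ε / 2) • w) 0 := by
    have h := (((Real.hasDerivAt_sin 0).const_mul (ε / 2)).smul_const w).const_add (φ p)
    rw [Real.cos_zero, mul_one] at h
    exact h
  refine ⟨fun s => φ.symm (c s), ε / 2, half_pos hε, ?_, ?_, ?_⟩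
  · exact ContMDiffOn.comp_contMDiff (contMDiffOn_extChartAt_symm p) hcs.contMDiff hct
  · change φ.symm (c 0) = p
    rw [hc0]
    exact extChartAt_to_inv p
  · intro f hf
    have hF : ContDiffAt ℝ ∞ (fun x => f (φ.symm x)) (φ p) := by
      have h := contMDiffWithinAt_extChartAt_symm_range_self (I := I) (n := ∞) p
      rw [I.range_eq_univ, contMDiffWithinAt_univ] at h
      exact ((hf _).comp _ h).contDiffAt
    have hfF : f =ᶠ[nhds p] fun q => (fun x => f (φ.symm x)) (φ q) := by
      filter_upwards [extChartAt_source_mem_nhds (I := I) p] with q hq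
      exact congrArg f (φ.left_inv hq).symm
    have hFd := hF.differentiableAt (by simp)
    rw [mvfderiv_congr hfF, mvfderiv_comp_extChartAt (mem_extChartAt_source p) hFd, ← hw,
      ← smul_eq_mul, ← map_smul]
    rw [← hc0] at hFd ⊢
    exact hFd.hasFDerivAt.comp_hasDerivAt 0 hcd

variable [I.Boundaryless] [IsManifold I ∞ M] [CompactSpace M] [MulAction Circle M]

/-- On a compact manifold with a circle action generated by `F`, a constant of the form
`A u - F v`, with an invariant field `A`, vanishes: at a maximum of the average of `u` over the
orbits, the average of `A u` vanishes. -/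
theorem eq_zero_of_sub_eq_const [Nonempty M]
    (hact : ContMDiff ((𝓡 1).prod I) I ∞ (fun q : Circle × M => q.1 • q.2))
    {A F : VecField I M}
    (hA : ∀ (w : Circle) (p : M), mfderiv I I (fun q : M => w • q) p (A p) = A (w • p))
    (hF : ∀ (p : M) (s : ℝ), mfderiv 𝓘(ℝ, ℝ) I (fun s : ℝ => Circle.exp (2 * Real.pi * s) • p) s
      (1 : ℝ) = F (Circle.exp (2 * Real.pi * s) • p))
    {u v : M → ℝ} (hu : ContMDiff I 𝓘(ℝ, ℝ) ∞ u) (hv : ContMDiff I 𝓘(ℝ, ℝ) ∞ v) {r : ℝ}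
    (h : ∀ p, mvfderiv I u p (A p) - mvfderiv I v p (F p) = r) : r = 0 := by
  have hexp : ContMDiff 𝓘(ℝ, ℝ) (𝓡 1) ∞ (fun t : ℝ => Circle.exp (2 * Real.pi * t)) :=
    contMDiff_circleExp.comp (contDiff_const.mul contDiff_id).contMDiff
  have hcont : Continuous fun q : M × ℝ => u (Circle.exp (2 * Real.pi * q.2) • q.1) :=
    hu.continuous.comp (hact.continuous.comp
      ((hexp.continuous.comp continuous_snd).prodMk continuous_fst))
  -- A maximum point of the orbit average of `u`. Continuity of the average suffices here; its
  -- derivative is taken only along one curve with velocity a positive multiple of `A p`.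
  obtain ⟨p, -, hp⟩ := isCompact_univ.exists_isMaxOn Set.univ_nonempty
    (f := fun q : M => ∫ t in (0 : ℝ)..1, u (Circle.exp (2 * Real.pi * t) • q))
    (intervalIntegral.continuous_parametric_intervalIntegral_of_continuous' hcont _ _).continuousOn
  obtain ⟨σ, ε, hε, hσ, hσ0, hσd⟩ := exists_curve (A p)
  let g : ℝ × ℝ → ℝ := fun q => u (Circle.exp (2 * Real.pi * q.2) • σ q.1)
  have hg : ContDiff ℝ ∞ g := by
    have h1 : ContMDiff 𝓘(ℝ, ℝ × ℝ) 𝓘(ℝ, ℝ) ∞ (Prod.fst : ℝ × ℝ → ℝ) := contDiff_fst.contMDiff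
    have h2 : ContMDiff 𝓘(ℝ, ℝ × ℝ) 𝓘(ℝ, ℝ) ∞ (Prod.snd : ℝ × ℝ → ℝ) := contDiff_snd.contMDiff
    exact (hu.comp (hact.comp ((hexp.comp h2).prodMk (hσ.comp h1)))).contDiff
  have hsmul : ∀ w : Circle, ContMDiff I I ∞ (fun q : M => w • q) := fun w =>
    hact.comp (contMDiff_const.prodMk contMDiff_id)
  -- Invariance of `A` moves the derivative through the translation by the circle element.
  have hgd : ∀ t, fderiv ℝ g (0, t) (1, 0) =
      ε * mvfderiv I u (Circle.exp (2 * Real.pi * t) • p) (A (Circle.exp (2 * Real.pi * t) • p)) := by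
    intro t
    have h1 : HasDerivAt (fun s : ℝ => (s, t)) ((1 : ℝ), (0 : ℝ)) 0 :=
      (hasDerivAt_id 0).prodMk (hasDerivAt_const 0 t)
    have h2 := (hg.differentiable (by simp) (0, t)).hasFDerivAt.comp_hasDerivAt 0 h1
    have h3 := hσd _ (hu.comp (hsmul (Circle.exp (2 * Real.pi * t))))
    rw [mvfderiv_comp_apply (I := I) (I' := I) p (hu.mdifferentiableAt (by simp))
      ((hsmul _).mdifferentiableAt (by simp)), hA] at h3
    exact h2.unique h3
  have hmax : IsLocalMax (fun s => ∫ t in (0 : ℝ)..1, g (s, t)) 0 := by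
    refine Filter.Eventually.of_forall fun s => ?_
    have := hp (Set.mem_univ (σ s))
    simp only [g, hσ0]
    exact this
  have h0 := hmax.hasDerivAt_eq_zero (hasDerivAt_intervalIntegral_of_contDiff
    (hg.of_le (WithTop.coe_le_coe.2 le_top)) 0)
  simp only [hgd, intervalIntegral.integral_const_mul] at h0
  have h1 := (mul_eq_zero.1 h0).resolve_left hε.ne'
  have hcA : Continuous fun t : ℝ =>
      mvfderiv I u (Circle.exp (2 * Real.pi * t) • p) (A (Circle.exp (2 * Real.pi * t) • p)) := by
    -- No regularity of `A` is assumed; the continuity of `A u` along the orbit is read off from the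
    -- smooth function `g`.
    have h2 : Continuous fun t : ℝ => ε⁻¹ * fderiv ℝ g (0, t) (1, 0) :=
      continuous_const.mul (((hg.continuous_fderiv (by simp)).comp
        (Continuous.prodMk_right (0 : ℝ))).clm_apply continuous_const)
    simpa only [hgd, inv_mul_cancel_left₀ hε.ne'] using h2
  have hvd : ∀ t : ℝ, HasDerivAt (fun t : ℝ => v (Circle.exp (2 * Real.pi * t) • p))
      (mvfderiv I u (Circle.exp (2 * Real.pi * t) • p) (A (Circle.exp (2 * Real.pi * t) • p)) - r)
      t := by
    intro t
    have horb : ContMDiff 𝓘(ℝ, ℝ) I ∞ (fun s : ℝ => Circle.exp (2 * Real.pi * s) • p) :=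
      hact.comp (hexp.prodMk contMDiff_const)
    have h2 := mvfderiv_comp_apply (I := I) (I' := 𝓘(ℝ, ℝ)) t (hv.mdifferentiableAt (by simp))
      (horb.mdifferentiableAt (x := t) (by simp)) (1 : ℝ)
    rw [hF p t] at h2
    have h3 : ContDiff ℝ ∞ (fun t : ℝ => v (Circle.exp (2 * Real.pi * t) • p)) :=
      (hv.comp horb).contDiff
    have h4 := (h3.differentiable (by simp) t).hasDerivAt
    have h5 : deriv (fun t : ℝ => v (Circle.exp (2 * Real.pi * t) • p)) t =
        mvfderiv I v (Circle.exp (2 * Real.pi * t) • p) (F (Circle.exp (2 * Real.pi * t) • p)) := by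
      rw [← h2, ← fderiv_apply_one_eq_deriv, mvfderiv, mfderiv_eq_fderiv]
      rfl
    rw [h5] at h4
    rw [← h (Circle.exp (2 * Real.pi * t) • p), sub_sub_cancel]
    exact h4
  -- The orbit closes up at time one, so the integral of `F v = A u - r` vanishes. As the integral
  -- of `A u` is zero too, only `r` remains.
  have h2 := intervalIntegral.integral_eq_sub_of_hasDerivAt (a := 0) (b := 1)
    (fun t _ => hvd t) ((hcA.sub continuous_const).intervalIntegrable _ _)
  rw [intervalIntegral.integral_sub (hcA.intervalIntegrable _ _) intervalIntegrable_const, h1]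
    at h2
  simpa using h2

end CircleAverage

/-! ### Structure equations from local coordinates. -/

section LocalForms

variable {E : Type*} [NormedAddCommGroup E] [NormedSpace ℝ E] {H : Type*} [TopologicalSpace H]
  {I : ModelWithCorners ℝ E H} {M : Type*} [TopologicalSpace M] [ChartedSpace H M]

/-- Locally `ζ = dz` and `θ = dx + r x dz` for smooth functions `x`, `z`. -/
def IsLocallyTwisted (θ ζ : OneForm I M) (r : ℝ) : Prop :=
  ∀ p : M, ∃ x z : M → ℝ, ContMDiffAt I 𝓘(ℝ, ℝ) ∞ x p ∧ ContMDiffAt I 𝓘(ℝ, ℝ) ∞ z p ∧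
    ∀ᶠ q in nhds p, θ q = mvfderiv I x q + (r * x q) • mvfderiv I z q ∧ ζ q = mvfderiv I z q

variable [IsManifold I ∞ M] {θ ζ : OneForm I M} {r : ℝ}

theorem contMDiffAt_mvfderiv_apply {f : M → ℝ} {p : M} (hf : ContMDiffAt I 𝓘(ℝ, ℝ) ∞ f p)
    {V : VecField I M} (hV : IsSmoothVecField V) :
    ContMDiffAt I 𝓘(ℝ, ℝ) ∞ (fun q => mvfderiv I f q (V q)) p := by
  have h := ContMDiffAt.clm_bundle_apply (contMDiffAt_mvfderiv hf) (hV p)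
  rw [Bundle.contMDiffAt_section] at h
  exact h

theorem IsLocallyTwisted.isSmoothOneForm (h : IsLocallyTwisted θ ζ r) : IsSmoothOneForm θ := by
  intro p
  obtain ⟨x, z, hx, hz, hxz⟩ := h p
  have h1 := (contMDiffAt_mvfderiv hx).add_section
    ((contMDiffAt_const (c := r).mul hx).smul_section (contMDiffAt_mvfderiv hz))
  refine h1.congr_of_eventuallyEq ?_
  filter_upwards [hxz] with q hq
  rw [hq.1]
  rfl

/-- Here d(dx + r x dz) = r dx∧dz, and dx may be replaced by θ because the two differ by a multiple
of dz. The second derivatives of x and z cancel by the bracket formula. -/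
theorem IsLocallyTwisted.isExtDeriv [I.Boundaryless] [CompleteSpace E]
    (h : IsLocallyTwisted θ ζ r) : IsExtDeriv θ (r • θ.wedge ζ) := by
  intro U V hU hV p
  obtain ⟨x, z, hx, hz, hxz⟩ := h p
  have key : ∀ (U V : VecField I M), IsSmoothVecField V →
      mvfderiv I (fun q => θ q (V q)) p (U p) =
        mvfderiv I (fun q => mvfderiv I x q (V q)) p (U p) +
        (r * x p * mvfderiv I (fun q => mvfderiv I z q (V q)) p (U p) +
          r * mvfderiv I x p (U p) * mvfderiv I z p (V p)) := by
    intro U V hV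
    have h1 : (fun q => θ q (V q)) =ᶠ[nhds p] (fun q => mvfderiv I x q (V q)) +
        (fun _ => r) * (x * fun q => mvfderiv I z q (V q)) := by
      filter_upwards [hxz] with q hq
      rw [hq.1]
      change _ = mvfderiv I x q (V q) + r * (x q * mvfderiv I z q (V q))
      rw [← mul_assoc]
      rfl
    have hxV := (contMDiffAt_mvfderiv_apply hx hV).mdifferentiableAt (by simp)
    have hzV := (contMDiffAt_mvfderiv_apply hz hV).mdifferentiableAt (by simp)
    have hxd := hx.mdifferentiableAt (by simp)
    have hxz := hxd.mul hzV
    rw [mvfderiv_congr h1, mvfderiv_add hxV (mdifferentiableAt_const.mul hxz),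
      mvfderiv_mul mdifferentiableAt_const hxz, mvfderiv_mul hxd hzV, mvfderiv_const]
    simp
    ring
  have hp := hxz.self_of_nhds
  rw [smul_wedge_apply, key U V hV, key V U hU, hp.1, hp.2]
  change _ = _ - (mvfderiv I x p _ + r * x p * mvfderiv I z p _)
  rw [mvfderiv_mlieBracket hU hV hx, mvfderiv_mlieBracket hU hV hz]
  change r * ((mvfderiv I x p _ + r * x p * mvfderiv I z p _) * _ -
    (mvfderiv I x p _ + r * x p * mvfderiv I z p _) * _) = _
  ring

end LocalForms

/-! ### Locality and functoriality of pull-backs. -/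

section Pullback

variable {E : Type*} [NormedAddCommGroup E] [NormedSpace ℝ E] {H : Type*} [TopologicalSpace H]
  {I : ModelWithCorners ℝ E H} {M : Type*} [TopologicalSpace M] [ChartedSpace H M]
  {E' : Type*} [NormedAddCommGroup E'] [NormedSpace ℝ E'] {H' : Type*} [TopologicalSpace H']
  {J : ModelWithCorners ℝ E' H'} {N : Type*} [TopologicalSpace N] [ChartedSpace H' N]
  {E'' : Type*} [NormedAddCommGroup E''] [NormedSpace ℝ E''] {H'' : Type*} [TopologicalSpace H'']
  {K : ModelWithCorners ℝ E'' H''} {P : Type*} [TopologicalSpace P] [ChartedSpace H'' P]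

theorem OneForm.apply_congr (θ : OneForm J N) {a b : N} (h : a = b) {v w : E'} (hv : v = w) :
    (θ a : E' →L[ℝ] ℝ) v = (θ b : E' →L[ℝ] ℝ) w := by
  subst h hv
  rfl

theorem OneForm.pullback_congr (θ : OneForm J N) {f g : M → N} {p : M} (h : f =ᶠ[nhds p] g) :
    OneForm.pullback (I := I) J f θ p = OneForm.pullback (I := I) J g θ p := by
  refine ContinuousLinearMap.ext fun v => ?_
  exact θ.apply_congr h.self_of_nhds (DFunLike.congr_fun (h.mfderiv_eq (I := I) (I' := J)) v)

theorem OneForm.pullback_comp (θ : OneForm K P) {g : N → P} {f : M → N} {p : M}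
    (hg : MDifferentiableAt J K g (f p)) (hf : MDifferentiableAt I J f p) :
    OneForm.pullback (I := I) K (g ∘ f) θ p =
      OneForm.pullback (I := I) J f (OneForm.pullback (I := J) K g θ) p := by
  refine ContinuousLinearMap.ext fun v => ?_
  exact θ.apply_congr rfl (mfderiv_comp_apply p hg hf v)

end Pullback

/-! ### The pull-backs of α, β, γ through local lifts to the group. -/

section BaseForms

namespace SolvGroup

variable {k : ℝ}

theorem contMDiff_x : ContMDiff 𝓘(ℝ, ℝ × ℝ × ℝ) 𝓘(ℝ, ℝ) ∞ (x : SolvGroup k → ℝ) :=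
  (show ContDiff ℝ ∞ (fun p : ℝ × ℝ × ℝ => p.1) from contDiff_fst).contMDiff

theorem contMDiff_y : ContMDiff 𝓘(ℝ, ℝ × ℝ × ℝ) 𝓘(ℝ, ℝ) ∞ (y : SolvGroup k → ℝ) :=
  (show ContDiff ℝ ∞ (fun p : ℝ × ℝ × ℝ => p.2.1) by fun_prop).contMDiff

theorem contMDiff_z : ContMDiff 𝓘(ℝ, ℝ × ℝ × ℝ) 𝓘(ℝ, ℝ) ∞ (z : SolvGroup k → ℝ) :=
  (show ContDiff ℝ ∞ (fun p : ℝ × ℝ × ℝ => p.2.2) by fun_prop).contMDiff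

variable (Γ : Subgroup (SolvGroup k)) [DiscreteTopology Γ]
  {E : Type*} [NormedAddCommGroup E] [NormedSpace ℝ E] {H : Type*} [TopologicalSpace H]
  {I : ModelWithCorners ℝ E H} {M : Type*} [TopologicalSpace M] [ChartedSpace H M]
  {π : M → SolvGroup k ⧸ Γ}

/-- A smooth map to the quotient lifts locally to the group. -/
theorem exists_local_lift (hπ : ContMDiff I 𝓘(ℝ, ℝ × ℝ × ℝ) ∞ π) (p : M) :
    ∃ g : M → SolvGroup k, ContMDiffAt I 𝓘(ℝ, ℝ × ℝ × ℝ) ∞ g p ∧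
      ∀ᶠ q in nhds p, (QuotientGroup.mk (g q) : SolvGroup k ⧸ Γ) = π q := by
  have hu : (QuotientGroup.mk (lift Γ (π p)) : SolvGroup k ⧸ Γ) = π p := mk_lift Γ (π p)
  have hl := isLocalDiffeomorph_quotientMk Γ (lift Γ (π p))
  refine ⟨fun q => hl.localInverse (π q), ?_, ?_⟩
  · have h := hl.localInverse_contMDiffAt
    rw [hu] at h
    exact h.comp p (hπ p)
  · have h := hl.localInverse_eventuallyEq_right
    rw [hu] at h
    exact (hπ.continuous.continuousAt (x := p)).eventually h

variable {Γ} in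
-- Near `p` the map `π` factors through the group as the projection after `g`, and the descended
-- form pulls back to `θ` on the group. Computations with the form on M thus take place in the
-- global coordinates of the group.
theorem pullback_descend_eventuallyEq [IsManifold I ∞ M]
    {g : M → SolvGroup k} {p : M} (hg : ContMDiffAt I 𝓘(ℝ, ℝ × ℝ × ℝ) ∞ g p)
    (hgπ : ∀ᶠ q in nhds p, (QuotientGroup.mk (g q) : SolvGroup k ⧸ Γ) = π q)
    {θ : OneForm 𝓘(ℝ, ℝ × ℝ × ℝ) (SolvGroup k)}
    (hθ : ∀ d : SolvGroup k, OneForm.pullback (I := 𝓘(ℝ, ℝ × ℝ × ℝ)) 𝓘(ℝ, ℝ × ℝ × ℝ)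
      (fun g : SolvGroup k => g * d) θ = θ) :
    ∀ᶠ q in nhds p, MDifferentiableAt I 𝓘(ℝ, ℝ × ℝ × ℝ) g q ∧
      OneForm.pullback (I := I) 𝓘(ℝ, ℝ × ℝ × ℝ) π (descend Γ θ) q =
        OneForm.pullback (I := I) 𝓘(ℝ, ℝ × ℝ × ℝ) g θ q := by
  have hg1 : ∀ᶠ q in nhds p, ContMDiffAt I 𝓘(ℝ, ℝ × ℝ × ℝ) 1 g q :=
    (contMDiffAt_iff_contMDiffAt_nhds (by simp)).1 (hg.of_le (WithTop.coe_le_coe.2 le_top))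
  filter_upwards [hg1, hgπ.eventually_nhds] with q h1 h2
  have h3 := h1.mdifferentiableAt one_ne_zero
  refine ⟨h3, ?_⟩
  have h4 : π =ᶠ[nhds q] QuotientGroup.mk ∘ g := h2.mono fun _ h => h.symm
  rw [OneForm.pullback_congr _ h4, OneForm.pullback_comp _
    ((isLocalDiffeomorph_quotientMk Γ _).mdifferentiableAt (by simp)) h3]
  rw [pullback_descend Γ θ hθ]

theorem mvfderiv_comp_lift {f : SolvGroup k → ℝ} (hf : ContMDiff 𝓘(ℝ, ℝ × ℝ × ℝ) 𝓘(ℝ, ℝ) ∞ f)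
    {g : M → SolvGroup k} {q : M} (hg : MDifferentiableAt I 𝓘(ℝ, ℝ × ℝ × ℝ) g q)
    (v : TangentSpace I q) :
    mvfderiv I (fun q => f (g q)) q v = mvfderiv 𝓘(ℝ, ℝ × ℝ × ℝ) f (g q)
      (mfderiv I 𝓘(ℝ, ℝ × ℝ × ℝ) g q v) :=
  mvfderiv_comp_apply (I := 𝓘(ℝ, ℝ × ℝ × ℝ)) (I' := I) q (hf.mdifferentiableAt (by simp)) hg v

variable {Γ} [IsManifold I ∞ M]

theorem isLocallyTwisted_alpha (hπ : ContMDiff I 𝓘(ℝ, ℝ × ℝ × ℝ) ∞ π) :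
    IsLocallyTwisted (OneForm.pullback (I := I) 𝓘(ℝ, ℝ × ℝ × ℝ) π (descend Γ (alphaG k)))
      (OneForm.pullback (I := I) 𝓘(ℝ, ℝ × ℝ × ℝ) π (descend Γ (gammaG k))) (-k) := by
  intro p
  obtain ⟨g, hg, hgπ⟩ := exists_local_lift Γ hπ p
  refine ⟨fun q => (g q).x, fun q => (g q).z, (contMDiff_x _).comp p hg,
    (contMDiff_z _).comp p hg, ?_⟩
  filter_upwards [pullback_descend_eventuallyEq hg hgπ alphaG_rightInvariant,
    pullback_descend_eventuallyEq hg hgπ gammaG_rightInvariant] with q hα hγ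
  rw [hα.2, hγ.2]
  refine ⟨ContinuousLinearMap.ext fun v => ?_, ContinuousLinearMap.ext fun v =>
    (mvfderiv_comp_lift contMDiff_z hγ.1 v).symm⟩
  let D : TangentSpace 𝓘(ℝ, ℝ × ℝ × ℝ) (g q) := mfderiv I 𝓘(ℝ, ℝ × ℝ × ℝ) g q v
  change mvfderiv 𝓘(ℝ, ℝ × ℝ × ℝ) x (g q) D -
    k * (g q).x * mvfderiv 𝓘(ℝ, ℝ × ℝ × ℝ) z (g q) D =
    mvfderiv I (fun q => (g q).x) q v + -k * (g q).x * mvfderiv I (fun q => (g q).z) q v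
  rw [mvfderiv_comp_lift contMDiff_x hα.1, mvfderiv_comp_lift contMDiff_z hα.1]
  change _ - _ = mvfderiv 𝓘(ℝ, ℝ × ℝ × ℝ) x (g q) D +
    -k * (g q).x * mvfderiv 𝓘(ℝ, ℝ × ℝ × ℝ) z (g q) D
  ring

theorem isLocallyTwisted_beta (hπ : ContMDiff I 𝓘(ℝ, ℝ × ℝ × ℝ) ∞ π) :
    IsLocallyTwisted (OneForm.pullback (I := I) 𝓘(ℝ, ℝ × ℝ × ℝ) π (descend Γ (betaG k)))
      (OneForm.pullback (I := I) 𝓘(ℝ, ℝ × ℝ × ℝ) π (descend Γ (gammaG k))) k := by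
  intro p
  obtain ⟨g, hg, hgπ⟩ := exists_local_lift Γ hπ p
  refine ⟨fun q => (g q).y, fun q => (g q).z, (contMDiff_y _).comp p hg,
    (contMDiff_z _).comp p hg, ?_⟩
  filter_upwards [pullback_descend_eventuallyEq hg hgπ betaG_rightInvariant,
    pullback_descend_eventuallyEq hg hgπ gammaG_rightInvariant] with q hβ hγ
  rw [hβ.2, hγ.2]
  refine ⟨ContinuousLinearMap.ext fun v => ?_, ContinuousLinearMap.ext fun v =>
    (mvfderiv_comp_lift contMDiff_z hγ.1 v).symm⟩
  let D : TangentSpace 𝓘(ℝ, ℝ × ℝ × ℝ) (g q) := mfderiv I 𝓘(ℝ, ℝ × ℝ × ℝ) g q v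
  change mvfderiv 𝓘(ℝ, ℝ × ℝ × ℝ) y (g q) D +
    k * (g q).y * mvfderiv 𝓘(ℝ, ℝ × ℝ × ℝ) z (g q) D =
    mvfderiv I (fun q => (g q).y) q v + k * (g q).y * mvfderiv I (fun q => (g q).z) q v
  rw [mvfderiv_comp_lift contMDiff_y hβ.1, mvfderiv_comp_lift contMDiff_z hβ.1]

theorem isLocallyTwisted_gamma (hπ : ContMDiff I 𝓘(ℝ, ℝ × ℝ × ℝ) ∞ π) :
    IsLocallyTwisted (OneForm.pullback (I := I) 𝓘(ℝ, ℝ × ℝ × ℝ) π (descend Γ (gammaG k)))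
      (OneForm.pullback (I := I) 𝓘(ℝ, ℝ × ℝ × ℝ) π (descend Γ (gammaG k))) 0 := by
  intro p
  obtain ⟨g, hg, hgπ⟩ := exists_local_lift Γ hπ p
  -- For twisting constant 0 both the form and its partner are dz, so z plays both roles.
  refine ⟨fun q => (g q).z, fun q => (g q).z, (contMDiff_z _).comp p hg,
    (contMDiff_z _).comp p hg, ?_⟩
  filter_upwards [pullback_descend_eventuallyEq hg hgπ gammaG_rightInvariant] with q hγ
  rw [hγ.2, zero_mul, zero_smul, add_zero, and_self]
  exact ContinuousLinearMap.ext fun v => (mvfderiv_comp_lift contMDiff_z hγ.1 v).symm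

end SolvGroup

end BaseForms

/-! ### Functions with zero differential. -/

section LocallyConstant

variable {E : Type*} [NormedAddCommGroup E] [NormedSpace ℝ E] {H : Type*} [TopologicalSpace H]
  {I : ModelWithCorners ℝ E H} {M : Type*} [TopologicalSpace M] [ChartedSpace H M]

theorem isLocallyConstant_of_mvfderiv_eq_zero [I.Boundaryless] [IsManifold I ∞ M] {f : M → ℝ}
    (hf : ContMDiff I 𝓘(ℝ, ℝ) ∞ f) (h : ∀ p, mvfderiv I f p = 0) : IsLocallyConstant f := by
  rw [IsLocallyConstant.iff_eventually_eq]
  intro p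
  set φ := extChartAt I p with hφ
  obtain ⟨ε, hε, hball⟩ := Metric.mem_nhds_iff.1 (extChartAt_target_mem_nhds (I := I) p)
  have hd : ∀ x ∈ Metric.ball (φ p) ε, HasFDerivAt (fun x => f (φ.symm x)) (0 : E →L[ℝ] ℝ) x := by
    intro x hx
    have hs : MDifferentiableAt 𝓘(ℝ, E) I φ.symm x :=
      ((contMDiffOn_extChartAt_symm (n := 1) p).contMDiffAt
        (extChartAt_target_mem_nhds' (hball hx))).mdifferentiableAt one_ne_zero
    have hf' : MDifferentiableAt I 𝓘(ℝ, ℝ) f (φ.symm x) := hf.mdifferentiableAt (by simp)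
    have h1 : HasMFDerivAt 𝓘(ℝ, E) 𝓘(ℝ, ℝ) (f ∘ φ.symm) x
        ((mfderiv I 𝓘(ℝ, ℝ) f (φ.symm x)).comp (mfderiv 𝓘(ℝ, E) I φ.symm x)) :=
      hf'.hasMFDerivAt.comp x hs.hasMFDerivAt
    have h2 : HasFDerivAt (f ∘ φ.symm) ((mfderiv I 𝓘(ℝ, ℝ) f (φ.symm x)).comp
        (mfderiv 𝓘(ℝ, E) I φ.symm x) : E →L[ℝ] ℝ) x := h1.hasFDerivAt
    have h3 : ((mfderiv I 𝓘(ℝ, ℝ) f (φ.symm x)).comp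
        (mfderiv 𝓘(ℝ, E) I φ.symm x) : E →L[ℝ] ℝ) = 0 :=
      ContinuousLinearMap.ext fun v =>
        DFunLike.congr_fun (h (φ.symm x)) (mfderiv 𝓘(ℝ, E) I φ.symm x v)
    rw [h3] at h2
    exact h2
  have hc : ∀ x ∈ Metric.ball (φ p) ε, f (φ.symm x) = f (φ.symm (φ p)) := fun x hx =>
    (convex_ball (φ p) ε).is_const_of_fderivWithin_eq_zero
      (fun y hy => (hd y hy).differentiableAt.differentiableWithinAt)
      (fun y hy => by
        rw [fderivWithin_of_isOpen Metric.isOpen_ball hy, (hd y hy).fderiv]) hx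
      (Metric.mem_ball_self hε)
  filter_upwards [(continuousAt_extChartAt (I := I) p).preimage_mem_nhds (Metric.ball_mem_nhds _ hε),
    extChartAt_source_mem_nhds (I := I) p] with q hq hqs
  have h1 := hc (φ q) hq
  rwa [φ.left_inv hqs, φ.left_inv (mem_extChartAt_source p)] at h1

end LocallyConstant

/-! ### Topology of principal circle bundles. -/

section PrincipalBundle

namespace IsPrincipalCircleBundle

variable {E : Type*} [NormedAddCommGroup E] [NormedSpace ℝ E] {H : Type*} [TopologicalSpace H]
  {I : ModelWithCorners ℝ E H} {M : Type*} [TopologicalSpace M] [ChartedSpace H M]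
  {E' : Type*} [NormedAddCommGroup E'] [NormedSpace ℝ E'] {H' : Type*} [TopologicalSpace H']
  {J : ModelWithCorners ℝ E' H'} {N : Type*} [TopologicalSpace N] [ChartedSpace H' N]
  [MulAction Circle M] {π : M → N}

theorem proj_smul (h : IsPrincipalCircleBundle (I := I) J π) (c : Circle) (p : M) :
    π (c • p) = π p := by
  obtain ⟨e, he, -, -, hc⟩ := h.exists_trivialization (π p)
  have hp : p ∈ e.source := e.mem_source.2 he
  have h1 := hc c p hp
  rw [← e.coe_fst hp, ← e.coe_fst h1.1, h1.2]

theorem exists_local_section (h : IsPrincipalCircleBundle (I := I) J π) (p : M) :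
    ∃ s : N → M, ContMDiffAt J I ∞ s (π p) ∧ s (π p) = p ∧ ∀ᶠ b in nhds (π p), π (s b) = b := by
  obtain ⟨e, he, -, hs, -⟩ := h.exists_trivialization (π p)
  have hp : p ∈ e.source := e.mem_source.2 he
  have ht : ∀ b ∈ e.baseSet, (b, (e p).2) ∈ e.target := fun b hb => e.mem_target.2 hb
  refine ⟨fun b => e.toOpenPartialHomeomorph.symm (b, (e p).2), ?_, ?_, ?_⟩
  · have h1 := hs.contMDiffAt (e.open_target.mem_nhds (ht _ he))
    exact h1.comp (π p) (contMDiffAt_id.prodMk contMDiffAt_const)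
  · have h2 : (π p, (e p).2) = e p := Prod.ext (e.coe_fst hp).symm rfl
    change e.toOpenPartialHomeomorph.symm (π p, (e p).2) = p
    rw [h2]
    exact e.left_inv hp
  · filter_upwards [e.open_baseSet.mem_nhds he] with b hb
    exact e.proj_symm_apply (ht b hb)

theorem surjective (h : IsPrincipalCircleBundle (I := I) J π) : Function.Surjective π := by
  intro b
  obtain ⟨e, he, -⟩ := h.exists_trivialization b
  exact ⟨e.toOpenPartialHomeomorph.symm (b, 1), e.proj_symm_apply (e.mem_target.2 he)⟩

theorem exists_smul_eq (h : IsPrincipalCircleBundle (I := I) J π) {p q : M} (hpq : π p = π q) :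
    ∃ c : Circle, c • p = q := by
  obtain ⟨e, he, -, -, hc⟩ := h.exists_trivialization (π p)
  have hp : p ∈ e.source := e.mem_source.2 he
  have hq : q ∈ e.source := e.mem_source.2 (hpq ▸ he)
  obtain ⟨h1, h2⟩ := hc ((e q).2 * (e p).2⁻¹) p hp
  refine ⟨(e q).2 * (e p).2⁻¹, e.injOn h1 hq ?_⟩
  refine h2.trans (Prod.ext
    ((e.coe_fst hp).trans (hpq.trans (e.coe_fst hq).symm)) (inv_mul_cancel_right _ _))

/-- Over a compact set inside a trivializing open set, the preimage is homeomorphic to a product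
with the circle; finitely many such sets cover the base. -/
theorem compactSpace [CompactSpace N] [LocallyCompactSpace N]
    (h : IsPrincipalCircleBundle (I := I) J π) : CompactSpace M := by
  have hloc : ∀ b : N, ∃ K ∈ nhds b, IsCompact (π ⁻¹' K) := by
    intro b
    obtain ⟨e, he, -⟩ := h.exists_trivialization b
    obtain ⟨K, hKb, hKe, hK⟩ := local_compact_nhds (e.open_baseSet.mem_nhds he)
    refine ⟨K, hKb, ?_⟩
    have hsub : K ×ˢ (Set.univ : Set Circle) ⊆ e.target := fun x hx => e.mem_target.2 (hKe hx.1)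
    have himg : π ⁻¹' K = e.toOpenPartialHomeomorph.symm '' (K ×ˢ Set.univ) := by
      ext p
      constructor
      · intro hp
        have hps : p ∈ e.source := e.mem_source.2 (hKe hp)
        refine ⟨e p, ⟨?_, trivial⟩, e.left_inv hps⟩
        rw [e.coe_fst hps]
        exact hp
      · rintro ⟨x, hx, rfl⟩
        change π (e.toOpenPartialHomeomorph.symm x) ∈ K
        rw [e.proj_symm_apply (hsub hx)]
        exact hx.1
    rw [himg]
    exact (hK.prod isCompact_univ).image_of_continuousOn
      (e.toOpenPartialHomeomorph.continuousOn_symm.mono hsub)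
  choose K hK hKc using hloc
  obtain ⟨t, ht⟩ := isCompact_univ.elim_nhds_subcover K fun b _ => hK b
  refine ⟨(t.isCompact_biUnion fun b _ => hKc b).of_isClosed_subset isClosed_univ fun p _ => ?_⟩
  obtain ⟨b, hb, hp⟩ := Set.mem_iUnion₂.1 (ht.2 (Set.mem_univ (π p)))
  exact Set.mem_iUnion₂.2 ⟨b, hb, hp⟩

/-- This replaces connectedness of M. The circle is connected, so `f` is constant on orbits, which
are the fibres; the induced function on the base is locally constant by local sections. -/
theorem eq_of_isLocallyConstant [PreconnectedSpace N] {Y : Type*}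
    (h : IsPrincipalCircleBundle (I := I) J π)
    {f : M → Y} (hf : IsLocallyConstant f) (p q : M) : f p = f q := by
  have horbit : ∀ (c : Circle) (p : M), f (c • p) = f p := by
    intro c p
    have h1 : IsLocallyConstant (fun c : Circle => f (c • p)) :=
      hf.comp_continuous (h.contMDiff_smul.continuous.comp (Continuous.prodMk_left p))
    have := h1.apply_eq_of_preconnectedSpace c 1
    rwa [one_smul] at this
  have hfib : ∀ p q : M, π p = π q → f p = f q := by
    intro p q hpq
    obtain ⟨c, rfl⟩ := h.exists_smul_eq hpq
    exact (horbit c p).symm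
  let w : N → Y := fun b => f (Function.surjInv h.surjective b)
  have hw : ∀ p, w (π p) = f p := fun p => hfib _ _ (Function.surjInv_eq h.surjective (π p))
  have hwl : IsLocallyConstant w := by
    rw [IsLocallyConstant.iff_eventually_eq]
    intro b
    obtain ⟨p, rfl⟩ := h.surjective b
    obtain ⟨s, hs, hsp, hsb⟩ := h.exists_local_section p
    have h1 := (IsLocallyConstant.iff_eventually_eq f).1 hf (s (π p))
    filter_upwards [hs.continuousAt.eventually h1, hsb] with b hb hb'
    rw [← hb', hw, hb, hsp, hw]
  rw [← hw, ← hw]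
  exact hwl.apply_eq_of_preconnectedSpace _ _

end IsPrincipalCircleBundle

end PrincipalBundle

/-! ### Invariance and horizontality of pull-backs from the base. -/

section PrincipalBundleForms

namespace IsPrincipalCircleBundle

variable {E : Type*} [NormedAddCommGroup E] [NormedSpace ℝ E] {H : Type*} [TopologicalSpace H]
  {I : ModelWithCorners ℝ E H} {M : Type*} [TopologicalSpace M] [ChartedSpace H M]
  {E' : Type*} [NormedAddCommGroup E'] [NormedSpace ℝ E'] {H' : Type*} [TopologicalSpace H']
  {J : ModelWithCorners ℝ E' H'} {N : Type*} [TopologicalSpace N] [ChartedSpace H' N]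
  [MulAction Circle M] {π : M → N}

theorem contMDiff_const_smul (h : IsPrincipalCircleBundle (I := I) J π) (c : Circle) :
    ContMDiff I I ∞ (fun p : M => c • p) :=
  h.contMDiff_smul.comp (contMDiff_const.prodMk contMDiff_id)

theorem contMDiff_orbit (h : IsPrincipalCircleBundle (I := I) J π) (p : M) :
    ContMDiff 𝓘(ℝ, ℝ) I ∞ (fun s : ℝ => Circle.exp (2 * Real.pi * s) • p) := by
  have h1 : ContMDiff 𝓘(ℝ, ℝ) 𝓘(ℝ, ℝ) ∞ (fun s : ℝ => 2 * Real.pi * s) :=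
    (contDiff_const.mul contDiff_id).contMDiff
  have h2 : ContMDiff 𝓘(ℝ, ℝ) (𝓡 1) ∞ (fun s : ℝ => Circle.exp (2 * Real.pi * s)) :=
    (contMDiff_circleExp (m := ∞)).comp h1
  exact h.contMDiff_smul.comp (h2.prodMk contMDiff_const)

/-- Pull-backs of forms from the base are invariant. -/
theorem pullback_smul_pullback (h : IsPrincipalCircleBundle (I := I) J π) (θ : OneForm J N)
    (c : Circle) :
    OneForm.pullback I (fun p : M => c • p) (OneForm.pullback (I := I) J π θ) =
      OneForm.pullback (I := I) J π θ := by
  funext p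
  rw [← OneForm.pullback_comp θ (h.contMDiff_proj.mdifferentiableAt (by simp))
    ((h.contMDiff_const_smul c).mdifferentiableAt (by simp))]
  exact congrFun (congrArg (fun f => OneForm.pullback (I := I) J f θ) (funext (h.proj_smul c))) p

/-- Pull-backs of forms from the base are horizontal. -/
theorem pullback_vertical (h : IsPrincipalCircleBundle (I := I) J π) (θ : OneForm J N) (p : M)
    (s : ℝ) :
    OneForm.pullback (I := I) J π θ (Circle.exp (2 * Real.pi * s) • p)
      (mfderiv 𝓘(ℝ, ℝ) I (fun s : ℝ => Circle.exp (2 * Real.pi * s) • p) s (1 : ℝ)) = 0 := by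
  have h1 := OneForm.pullback_comp (I := 𝓘(ℝ, ℝ)) (J := I) θ
    (f := fun s : ℝ => Circle.exp (2 * Real.pi * s) • p) (p := s)
    (h.contMDiff_proj.mdifferentiableAt (by simp)) ((h.contMDiff_orbit p).mdifferentiableAt (by simp))
  have h2 : π ∘ (fun s : ℝ => Circle.exp (2 * Real.pi * s) • p) = fun _ => π p :=
    funext fun s => h.proj_smul _ p
  have h3 : OneForm.pullback (I := 𝓘(ℝ, ℝ)) J (fun _ : ℝ => π p) θ s = 0 := by
    rw [OneForm.pullback, mfderiv_const]
    exact ContinuousLinearMap.comp_zero _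
  rw [h2, h3] at h1
  exact (DFunLike.congr_fun h1 (1 : ℝ)).symm

end IsPrincipalCircleBundle

end PrincipalBundleForms

/-! ### Invariant coframes and the vanishing of the constant. -/

section InvariantCoframe

variable {E : Type*} [NormedAddCommGroup E] [NormedSpace ℝ E] {H : Type*} [TopologicalSpace H]
  {I : ModelWithCorners ℝ E H} {M : Type*} [TopologicalSpace M] [ChartedSpace H M]
  [MulAction Circle M]

/-- A coframe with the structure equations of `IsSolvCoframe`, invariant under a circle action whose
velocity is dual to the last form. -/
structure IsInvariantSolvCoframe [IsManifold I 1 M] (α β γ η : OneForm I M) (c k : ℝ) : Prop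
    extends IsSolvCoframe α β γ η c k where
  invariant_α : ∀ w : Circle, OneForm.pullback I (fun p : M => w • p) α = α
  invariant_β : ∀ w : Circle, OneForm.pullback I (fun p : M => w • p) β = β
  invariant_γ : ∀ w : Circle, OneForm.pullback I (fun p : M => w • p) γ = γ
  invariant_η : ∀ w : Circle, OneForm.pullback I (fun p : M => w • p) η = η
  vertical_α : ∀ (p : M) (s : ℝ), α (Circle.exp (2 * Real.pi * s) • p)
    (mfderiv 𝓘(ℝ, ℝ) I (fun s : ℝ => Circle.exp (2 * Real.pi * s) • p) s (1 : ℝ)) = 0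
  vertical_β : ∀ (p : M) (s : ℝ), β (Circle.exp (2 * Real.pi * s) • p)
    (mfderiv 𝓘(ℝ, ℝ) I (fun s : ℝ => Circle.exp (2 * Real.pi * s) • p) s (1 : ℝ)) = 0
  vertical_γ : ∀ (p : M) (s : ℝ), γ (Circle.exp (2 * Real.pi * s) • p)
    (mfderiv 𝓘(ℝ, ℝ) I (fun s : ℝ => Circle.exp (2 * Real.pi * s) • p) s (1 : ℝ)) = 0
  vertical_η : ∀ (p : M) (s : ℝ), η (Circle.exp (2 * Real.pi * s) • p)
    (mfderiv 𝓘(ℝ, ℝ) I (fun s : ℝ => Circle.exp (2 * Real.pi * s) • p) s (1 : ℝ)) = 1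

namespace IsInvariantSolvCoframe

theorem symm [IsManifold I 1 M] {α β γ η : OneForm I M} {c k : ℝ}
    (h : IsInvariantSolvCoframe α β γ η c k) : IsInvariantSolvCoframe β α γ η (-c) (-k) where
  toIsSolvCoframe := h.toIsSolvCoframe.swap
  invariant_α := h.invariant_β
  invariant_β := h.invariant_α
  invariant_γ := h.invariant_γ
  invariant_η := h.invariant_η
  vertical_α := h.vertical_β
  vertical_β := h.vertical_α
  vertical_γ := h.vertical_γ
  vertical_η := h.vertical_η

variable [IsManifold I ∞ M] {α β γ η : OneForm I M} {c k : ℝ}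

/-- A vector is determined by its values on the coframe. Invariance of the coframe makes these equal
on both sides. -/
theorem mfderiv_smul_frameField (h : IsInvariantSolvCoframe α β γ η c k) {A : VecField I M}
    {a b z e : ℝ} (hA : IsFrameField α β γ η A a b z e) (w : Circle) (p : M) :
    mfderiv I I (fun q : M => w • q) p (A p) = A (w • p) := by
  apply h.ext_vector
  · exact (DFunLike.congr_fun (congrFun (h.invariant_α w) p) (A p)).trans
      ((hA.α_eq p).trans (hA.α_eq _).symm)
  · exact (DFunLike.congr_fun (congrFun (h.invariant_β w) p) (A p)).trans
      ((hA.β_eq p).trans (hA.β_eq _).symm)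
  · exact (DFunLike.congr_fun (congrFun (h.invariant_γ w) p) (A p)).trans
      ((hA.γ_eq p).trans (hA.γ_eq _).symm)
  · exact (DFunLike.congr_fun (congrFun (h.invariant_η w) p) (A p)).trans
      ((hA.η_eq p).trans (hA.η_eq _).symm)

theorem mfderiv_orbit (h : IsInvariantSolvCoframe α β γ η c k) {F : VecField I M}
    (hF : IsFrameField α β γ η F 0 0 0 1) (p : M) (s : ℝ) :
    mfderiv 𝓘(ℝ, ℝ) I (fun s : ℝ => Circle.exp (2 * Real.pi * s) • p) s (1 : ℝ) =
      F (Circle.exp (2 * Real.pi * s) • p) := by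
  apply h.ext_vector
  · exact (h.vertical_α p s).trans (hF.α_eq _).symm
  · exact (h.vertical_β p s).trans (hF.β_eq _).symm
  · exact (h.vertical_γ p s).trans (hF.γ_eq _).symm
  · exact (h.vertical_η p s).trans (hF.η_eq _).symm

/-- The defect `l` is locally constant, hence constant by `hconst`. Being of the form `A u - F v` up
to the nonzero factor t₁, it vanishes by orbit averaging. -/
theorem conformalFactor_eq [I.Boundaryless] [FiniteDimensional ℝ E] (hE : Module.finrank ℝ E = 4)
    [CompactSpace M] (h : IsInvariantSolvCoframe α β γ η c k)
    (hact : ContMDiff ((𝓡 1).prod I) I ∞ (fun q : Circle × M => q.1 • q.2))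
    (hconst : ∀ f : M → ℝ, IsLocallyConstant f → ∀ p q, f p = f q)
    {t₁ t₂ t₃ : ℝ} (h12 : t₁ * t₂ ≠ 0) (hd : t₁ * t₂ ≠ c * k * t₃ ^ 2)
    {X : VecField I M} (hX : IsSmoothVecField X) {f : M → ℝ}
    (hf : IsConformalAlong X (omegaT α β γ η c k t₁ t₂ t₃) f) (p : M) :
    f p = k * γ p (X p) := by
  have : Nonempty M := ⟨p⟩
  have : CompleteSpace E := FiniteDimensional.complete ℝ E
  obtain ⟨A, hA⟩ := h.exists_frameField hE 1 0 0 0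
  obtain ⟨B, hB⟩ := h.exists_frameField hE 0 1 0 0
  obtain ⟨C, hC⟩ := h.exists_frameField hE 0 0 1 0
  obtain ⟨F, hF⟩ := h.exists_frameField hE 0 0 0 1
  obtain ⟨l, u, v, hfl, hl, huv⟩ := h.conformalFactor hA hB hC hF h12 hd hX hf
  have hl' := isLocallyConstant_of_mvfderiv_eq_zero l.contMDiff hl
  have h0 : t₁ * l p = 0 := eq_zero_of_sub_eq_const hact (h.mfderiv_smul_frameField hA)
    (h.mfderiv_orbit hF) u.contMDiff v.contMDiff fun q => by rw [huv, hconst l hl' q p]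
  rw [hfl, (mul_eq_zero.1 h0).resolve_left (left_ne_zero_of_mul h12), add_zero]

end IsInvariantSolvCoframe

end InvariantCoframe

/-! ### The invariant coframe on the total space. -/

namespace SolvGroup

variable {k : ℝ} {Γ : Subgroup (SolvGroup k)} [DiscreteTopology Γ]
  {E : Type*} [NormedAddCommGroup E] [NormedSpace ℝ E] {H : Type*} [TopologicalSpace H]
  {I : ModelWithCorners ℝ E H} {M : Type*} [TopologicalSpace M] [ChartedSpace H M]
  [MulAction Circle M] {π : M → SolvGroup k ⧸ Γ}

instance : LocallyCompactSpace (SolvGroup k ⧸ Γ) :=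
  ChartedSpace.locallyCompactSpace (ℝ × ℝ × ℝ) (SolvGroup k ⧸ Γ)

instance : PreconnectedSpace (SolvGroup k) := inferInstanceAs (PreconnectedSpace (ℝ × ℝ × ℝ))

instance : PreconnectedSpace (SolvGroup k ⧸ Γ) :=
  ⟨(QuotientGroup.mk_surjective (s := Γ)).range_eq ▸
    isPreconnected_range QuotientGroup.continuous_mk⟩

/-- A tangent vector of the group has a horizontal lift. -/
theorem exists_tangent_lift (hπ : IsPrincipalCircleBundle (I := I) 𝓘(ℝ, ℝ × ℝ × ℝ) π) (p : M)
    (w : ℝ × ℝ × ℝ) :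
    ∃ v : TangentSpace I p, ∀ θ : OneForm 𝓘(ℝ, ℝ × ℝ × ℝ) (SolvGroup k),
      (∀ d : SolvGroup k, OneForm.pullback (I := 𝓘(ℝ, ℝ × ℝ × ℝ)) 𝓘(ℝ, ℝ × ℝ × ℝ)
        (fun g : SolvGroup k => g * d) θ = θ) →
      OneForm.pullback (I := I) 𝓘(ℝ, ℝ × ℝ × ℝ) π (descend Γ θ) p v =
        (θ (lift Γ (π p)) : ℝ × ℝ × ℝ →L[ℝ] ℝ) w := by
  obtain ⟨s, hs, hsp, hsb⟩ := hπ.exists_local_section p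
  set u := lift Γ (π p)
  have hu : (QuotientGroup.mk u : SolvGroup k ⧸ Γ) = π p := mk_lift Γ (π p)
  have hmk : ContMDiffAt 𝓘(ℝ, ℝ × ℝ × ℝ) 𝓘(ℝ, ℝ × ℝ × ℝ) ∞
    (QuotientGroup.mk : SolvGroup k → SolvGroup k ⧸ Γ) u :=
    (isLocalDiffeomorph_quotientMk Γ u).contMDiffAt
  rw [← hu] at hs hsb
  have hc : ContMDiffAt 𝓘(ℝ, ℝ × ℝ × ℝ) I ∞ (s ∘ (QuotientGroup.mk : SolvGroup k → _)) u :=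
    hs.comp u hmk
  refine ⟨(mfderiv 𝓘(ℝ, ℝ × ℝ × ℝ) I (s ∘ (QuotientGroup.mk : SolvGroup k → _)) u :
    (ℝ × ℝ × ℝ) →L[ℝ] E) w, fun θ hθ => ?_⟩
  have h1 := OneForm.pullback_comp (I := 𝓘(ℝ, ℝ × ℝ × ℝ)) (J := I) (descend Γ θ) (p := u)
    (hπ.contMDiff_proj.mdifferentiableAt (by simp)) (hc.mdifferentiableAt (by simp))
  have h2 : (π ∘ s ∘ (QuotientGroup.mk : SolvGroup k → _)) =ᶠ[nhds u]
      (QuotientGroup.mk : SolvGroup k → SolvGroup k ⧸ Γ) :=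
    hmk.continuousAt.eventually hsb
  rw [OneForm.pullback_congr _ h2, pullback_descend Γ θ hθ] at h1
  refine Eq.trans ?_ (DFunLike.congr_fun h1 w).symm
  refine OneForm.apply_congr _ ?_ rfl
  rw [Function.comp_apply, hu, hsp]

variable [IsManifold I ∞ M] {η : OneForm I M}

/-- By equality of dimensions it is enough that the four values be prescribable. Those of α, β, γ
are realized by lifting a tangent vector of the group, and that of η is then corrected vertically.
-/
theorem injective_coframe [FiniteDimensional ℝ E] (hE : Module.finrank ℝ E = 4)
    (hπ : IsPrincipalCircleBundle (I := I) 𝓘(ℝ, ℝ × ℝ × ℝ) π)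
    (hη : IsConnectionForm η) (p : M) (v : TangentSpace I p)
    (h1 : OneForm.pullback (I := I) 𝓘(ℝ, ℝ × ℝ × ℝ) π (descend Γ (alphaG k)) p v = 0)
    (h2 : OneForm.pullback (I := I) 𝓘(ℝ, ℝ × ℝ × ℝ) π (descend Γ (betaG k)) p v = 0)
    (h3 : OneForm.pullback (I := I) 𝓘(ℝ, ℝ × ℝ × ℝ) π (descend Γ (gammaG k)) p v = 0)
    (h4 : η p v = 0) : v = 0 := by
  have hp : Circle.exp (2 * Real.pi * 0) • p = p := by
    rw [mul_zero, Circle.exp_zero, one_smul]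
  set α := OneForm.pullback (I := I) 𝓘(ℝ, ℝ × ℝ × ℝ) π (descend Γ (alphaG k)) with hα
  set β := OneForm.pullback (I := I) 𝓘(ℝ, ℝ × ℝ × ℝ) π (descend Γ (betaG k)) with hβ
  set γ := OneForm.pullback (I := I) 𝓘(ℝ, ℝ × ℝ × ℝ) π (descend Γ (gammaG k)) with hγ
  let F : E := mfderiv 𝓘(ℝ, ℝ) I (fun s : ℝ => Circle.exp (2 * Real.pi * s) • p) 0 (1 : ℝ)
  let a : E →L[ℝ] ℝ := α p
  let b : E →L[ℝ] ℝ := β p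
  let c : E →L[ℝ] ℝ := γ p
  let e : E →L[ℝ] ℝ := η p
  have hFα : a F = 0 :=
    (α.apply_congr hp.symm rfl).trans (hπ.pullback_vertical _ p 0)
  have hFβ : b F = 0 :=
    (β.apply_congr hp.symm rfl).trans (hπ.pullback_vertical _ p 0)
  have hFγ : c F = 0 :=
    (γ.apply_congr hp.symm rfl).trans (hπ.pullback_vertical _ p 0)
  have hFη : e F = 1 :=
    (η.apply_congr hp.symm rfl).trans (hη.vertical p 0)
  let T : E →ₗ[ℝ] Fin 4 → ℝ := LinearMap.pi
    ![a.toLinearMap, b.toLinearMap, c.toLinearMap,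
      e.toLinearMap]
  have hT : Function.Surjective T := by
    intro y
    set u := lift Γ (π p)
    -- The solution of dx - kx dz = y₀, dy + ky dz = y₁, dz = y₂ at the point `u`.
    obtain ⟨(v : E), hv⟩ := exists_tangent_lift hπ p (y 0 + k * u.x * y 2, y 1 - k * u.y * y 2, y 2)
    have e1 : a v = y 0 := by
      refine (hv _ alphaG_rightInvariant).trans ?_
      change mvfderiv 𝓘(ℝ, ℝ × ℝ × ℝ) x u _ - (k * u.x) * mvfderiv 𝓘(ℝ, ℝ × ℝ × ℝ) z u _ = _
      rw [mvfderiv_x, mvfderiv_z]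
      ring
    have e2 : b v = y 1 := by
      refine (hv _ betaG_rightInvariant).trans ?_
      change mvfderiv 𝓘(ℝ, ℝ × ℝ × ℝ) SolvGroup.y u _ +
        (k * u.y) * mvfderiv 𝓘(ℝ, ℝ × ℝ × ℝ) z u _ = _
      rw [mvfderiv_y, mvfderiv_z]
      ring
    have e3 : c v = y 2 := by
      refine (hv _ gammaG_rightInvariant).trans ?_
      exact mvfderiv_z u _
    -- Adding a multiple of the vertical vector changes only the value of η.
    refine ⟨v + (y 3 - e v) • F, ?_⟩
    have key : ∀ L : E →L[ℝ] ℝ, L (v + (y 3 - e v) • F) =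
        L v + (y 3 - e v) * L F := fun L => by
      rw [map_add, map_smul, smul_eq_mul]
    funext i
    fin_cases i
    · exact (key a).trans (by rw [e1, hFα, mul_zero, add_zero]; rfl)
    · exact (key b).trans (by rw [e2, hFβ, mul_zero, add_zero]; rfl)
    · exact (key c).trans (by rw [e3, hFγ, mul_zero, add_zero]; rfl)
    · exact (key e).trans (by rw [hFη, mul_one, add_sub_cancel]; rfl)
  have hinj := (LinearMap.injective_iff_surjective_of_finrank_eq_finrank
    (by rw [hE, Module.finrank_fin_fun])).2 hT
  refine hinj (a₁ := (v : E)) (a₂ := 0) ?_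
  rw [map_zero]
  funext i
  fin_cases i
  exacts [h1, h2, h3, h4]

theorem isInvariantSolvCoframe [I.Boundaryless] [FiniteDimensional ℝ E]
    (hE : Module.finrank ℝ E = 4)
    (hπ : IsPrincipalCircleBundle (I := I) 𝓘(ℝ, ℝ × ℝ × ℝ) π)
    (hη : IsConnectionForm η) {c : ℝ}
    (hcurv : IsExtDeriv η (c • (OneForm.pullback (I := I) 𝓘(ℝ, ℝ × ℝ × ℝ) π
      (descend Γ (alphaG k))).wedge
        (OneForm.pullback (I := I) 𝓘(ℝ, ℝ × ℝ × ℝ) π (descend Γ (betaG k))))) :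
    IsInvariantSolvCoframe
      (OneForm.pullback (I := I) 𝓘(ℝ, ℝ × ℝ × ℝ) π (descend Γ (alphaG k)))
      (OneForm.pullback (I := I) 𝓘(ℝ, ℝ × ℝ × ℝ) π (descend Γ (betaG k)))
      (OneForm.pullback (I := I) 𝓘(ℝ, ℝ × ℝ × ℝ) π (descend Γ (gammaG k))) η c k := by
  have : CompleteSpace E := FiniteDimensional.complete ℝ E
  have hπ' := hπ.contMDiff_proj
  exact
  { smooth_α := (isLocallyTwisted_alpha hπ').isSmoothOneForm
    smooth_β := (isLocallyTwisted_beta hπ').isSmoothOneForm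
    smooth_γ := (isLocallyTwisted_gamma hπ').isSmoothOneForm
    smooth_η := hη.smooth
    extDeriv_α := (isLocallyTwisted_alpha hπ').isExtDeriv
    extDeriv_β := (isLocallyTwisted_beta hπ').isExtDeriv
    extDeriv_γ := by
      have h := (isLocallyTwisted_gamma hπ').isExtDeriv
      rwa [show ∀ Θ : TwoForm I M, (0 : ℝ) • Θ = 0 from fun Θ => funext fun p =>
        zero_smul ℝ (Θ p)] at h
    extDeriv_η := hcurv
    injective := injective_coframe hE hπ hη
    invariant_α := hπ.pullback_smul_pullback _
    invariant_β := hπ.pullback_smul_pullback _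
    invariant_γ := hπ.pullback_smul_pullback _
    invariant_η := hη.invariant
    vertical_α := hπ.pullback_vertical _
    vertical_β := hπ.pullback_vertical _
    vertical_γ := hπ.pullback_vertical _
    vertical_η := hη.vertical }

end SolvGroup

/-! ### The Lee form and its uniqueness. -/

section LeeForm

variable {E : Type*} [NormedAddCommGroup E] [NormedSpace ℝ E] {H : Type*} [TopologicalSpace H]
  {I : ModelWithCorners ℝ E H} {M : Type*} [TopologicalSpace M] [ChartedSpace H M]
  [IsManifold I ∞ M]

/-- The exterior derivative of the 2-form `Ω`, which has differentiable coefficients, has the values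
`D`. -/
structure HasExtDeriv (Ω : TwoForm I M)
    (D : ∀ p : M, TangentSpace I p → TangentSpace I p → TangentSpace I p → ℝ) : Prop where
  mdifferentiable : ∀ U V : VecField I M, IsSmoothVecField U → IsSmoothVecField V →
    MDifferentiable I 𝓘(ℝ, ℝ) (fun q => Ω q ![U q, V q])
  extDerivApply_eq : ∀ U V W : VecField I M, IsSmoothVecField U → IsSmoothVecField V →
    IsSmoothVecField W → ∀ p : M, Ω.extDerivApply U V W p = D p (U p) (V p) (W p)

namespace HasExtDeriv

variable {Ω Ω' : TwoForm I M}
  {D D' : ∀ p : M, TangentSpace I p → TangentSpace I p → TangentSpace I p → ℝ}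

theorem add (h : HasExtDeriv Ω D) (h' : HasExtDeriv Ω' D') :
    HasExtDeriv (Ω + Ω') (fun p u v w => D p u v w + D' p u v w) where
  mdifferentiable U V hU hV := (h.mdifferentiable U V hU hV).add (h'.mdifferentiable U V hU hV)
  extDerivApply_eq U V W hU hV hW p := by
    have key : ∀ U V : VecField I M, IsSmoothVecField U → IsSmoothVecField V →
        ∀ w : TangentSpace I p, mvfderiv I (fun q => (Ω + Ω') q ![U q, V q]) p w =
          mvfderiv I (fun q => Ω q ![U q, V q]) p w +
            mvfderiv I (fun q => Ω' q ![U q, V q]) p w := fun U V hU hV w =>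
      DFunLike.congr_fun (mvfderiv_add (h.mdifferentiable U V hU hV p)
        (h'.mdifferentiable U V hU hV p)) w
    rw [← h.extDerivApply_eq U V W hU hV hW, ← h'.extDerivApply_eq U V W hU hV hW,
      TwoForm.extDerivApply, key V W hV hW, key U W hU hW, key U V hU hV]
    simp only [TwoForm.extDerivApply, Pi.add_apply, ContinuousAlternatingMap.add_apply]
    ring

theorem smul (h : HasExtDeriv Ω D) (r : ℝ) :
    HasExtDeriv (r • Ω) (fun p u v w => r * D p u v w) where
  mdifferentiable U V hU hV := (h.mdifferentiable U V hU hV).const_smul r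
  extDerivApply_eq U V W hU hV hW p := by
    have key : ∀ U V : VecField I M, IsSmoothVecField U → IsSmoothVecField V →
        ∀ w : TangentSpace I p, mvfderiv I (fun q => (r • Ω) q ![U q, V q]) p w =
          r * mvfderiv I (fun q => Ω q ![U q, V q]) p w := fun U V hU hV w =>
      mvfderiv_const_mul_apply (h.mdifferentiable U V hU hV p) r w
    rw [← h.extDerivApply_eq U V W hU hV hW, TwoForm.extDerivApply, key V W hV hW, key U W hU hW,
      key U V hU hV]
    simp only [TwoForm.extDerivApply, Pi.smul_apply, ContinuousAlternatingMap.smul_apply,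
      smul_eq_mul]
    ring

end HasExtDeriv

/-- The product rule `d(θ ∧ ζ) = dθ ∧ ζ - θ ∧ dζ`. -/
theorem IsExtDeriv.hasExtDeriv_wedge {θ ζ : OneForm I M} {Θ Z : TwoForm I M}
    (hθ : IsSmoothOneForm θ) (hζ : IsSmoothOneForm ζ) (h : IsExtDeriv θ Θ) (h' : IsExtDeriv ζ Z) :
    HasExtDeriv (θ.wedge ζ)
      (fun p u v w => ζ.wedgeTwoApply Θ p u v w - θ.wedgeTwoApply Z p u v w) := by
  have hd : ∀ {ξ : OneForm I M}, IsSmoothOneForm ξ → ∀ {U : VecField I M}, IsSmoothVecField U →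
      MDifferentiable I 𝓘(ℝ, ℝ) (fun q => ξ q (U q)) := fun hξ _ hU =>
    (hξ.contMDiff_apply hU).mdifferentiable (by simp)
  constructor
  · intro U V hU hV
    simp only [OneForm.wedge_apply]
    exact ((hd hθ hU).mul (hd hζ hV)).sub ((hd hθ hV).mul (hd hζ hU))
  · intro U V W hU hV hW p
    have key : ∀ U V : VecField I M, IsSmoothVecField U → IsSmoothVecField V →
        ∀ w : TangentSpace I p, mvfderiv I (fun q => θ.wedge ζ q ![U q, V q]) p w =
          (θ p (U p) * mvfderiv I (fun q => ζ q (V q)) p w +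
            mvfderiv I (fun q => θ q (U q)) p w * ζ p (V p)) -
          (θ p (V p) * mvfderiv I (fun q => ζ q (U q)) p w +
            mvfderiv I (fun q => θ q (V q)) p w * ζ p (U p)) := by
      intro U V hU hV w
      have e : (fun q => θ.wedge ζ q ![U q, V q]) =
          (fun q => θ q (U q)) * (fun q => ζ q (V q)) - (fun q => θ q (V q)) * fun q => ζ q (U q) :=
        funext fun q => OneForm.wedge_apply θ ζ q (U q) (V q)
      rw [e, mvfderiv_sub ((hd hθ hU p).mul (hd hζ hV p)) ((hd hθ hV p).mul (hd hζ hU p)),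
        mvfderiv_mul (hd hθ hU p) (hd hζ hV p), mvfderiv_mul (hd hθ hV p) (hd hζ hU p)]
      simp
      ring
    rw [TwoForm.extDerivApply, key V W hV hW, key U W hU hW, key U V hU hV]
    simp only [OneForm.wedgeTwoApply, OneForm.wedge_apply]
    rw [h U V hU hV, h U W hU hW, h V W hV hW, h' U V hU hV, h' U W hU hW, h' V W hV hW]
    ring

namespace IsSolvCoframe

variable {α β γ η : OneForm I M} {c k : ℝ}

/-- The Lee form of `omegaT` is `-k γ`. -/
theorem isLeeForm_omegaT (h : IsSolvCoframe α β γ η c k) (t₁ t₂ t₃ : ℝ) :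
    IsLeeForm (omegaT α β γ η c k t₁ t₂ t₃) (-k • γ) where
  smooth := by
    have h1 := h.smooth_γ.const_smul_section (a := -k)
    exact h1
  closed U V hU hV p := by
    have hd : ∀ {U : VecField I M}, IsSmoothVecField U →
        ∀ w : TangentSpace I p, mvfderiv I (fun q => (-k • γ) q (U q)) p w =
          -k * mvfderiv I (fun q => γ q (U q)) p w := fun hU w =>
      mvfderiv_const_mul_apply ((h.smooth_γ.contMDiff_apply hU).mdifferentiableAt (by simp)) (-k) w
    have h2 := h.extDeriv_γ U V hU hV p
    rw [hd hV, hd hU]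
    change 0 = _ - _ - (-k) * γ p _
    change 0 = _ at h2
    linear_combination -k * h2
  extDeriv_eq U V W hU hV hW p := by
    -- Here d(α∧η) = kγ∧α∧η, while d(β∧γ) = d(α∧β) = 0 and d(γ∧η) = -cγ∧α∧β. Therefore dΩ = kγ∧Ω
    -- holds for the combination cα∧β - kγ∧η, though in general not for its two terms separately.
    have hαη := h.extDeriv_α.hasExtDeriv_wedge h.smooth_α h.smooth_η h.extDeriv_η
    have hβγ := h.extDeriv_β.hasExtDeriv_wedge h.smooth_β h.smooth_γ h.extDeriv_γ
    have hαβ := h.extDeriv_α.hasExtDeriv_wedge h.smooth_α h.smooth_β h.extDeriv_β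
    have hγη := h.extDeriv_γ.hasExtDeriv_wedge h.smooth_γ h.smooth_η h.extDeriv_η
    have e : omegaT α β γ η c k t₁ t₂ t₃ = t₁ • α.wedge η + t₂ • β.wedge γ +
        t₃ • (c • α.wedge β + -k • γ.wedge η) := by
      rw [omegaT, sub_eq_add_neg,
        show -k • γ.wedge η = -(k • γ.wedge η) from
          funext fun p => neg_smul k (γ.wedge η p)]
    have h1 := ((hαη.smul t₁).add (hβγ.smul t₂)).add (((hαβ.smul c).add (hγη.smul (-k))).smul t₃)
    rw [← e] at h1
    rw [h1.extDerivApply_eq U V W hU hV hW]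
    simp only [OneForm.wedgeTwoApply, omegaT_apply, smul_wedge_apply]
    have e0 : ∀ u v : TangentSpace I p, (0 : TwoForm I M) p ![u, v] = 0 := fun _ _ => rfl
    have eγ : ∀ u : TangentSpace I p, (-k • γ) p u = -k * γ p u := fun _ => rfl
    simp only [e0, eγ]
    ring

/-- Both forms have the same wedge product with Ω, and wedging with a nondegenerate 2-form is
injective on 1-forms in dimension 4. On the frame this is linear algebra: the Pfaffian gives the
values on `A` and `B`, after which t₁ and t₂ can be divided out to reach `C` and `F`. -/
theorem eq_of_isLeeForm [FiniteDimensional ℝ E] (hE : Module.finrank ℝ E = 4)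
    (h : IsSolvCoframe α β γ η c k) {t₁ t₂ t₃ : ℝ}
    (h12 : t₁ * t₂ ≠ 0) (hd : t₁ * t₂ ≠ c * k * t₃ ^ 2) {θ θ' : OneForm I M}
    (hθ : IsLeeForm (omegaT α β γ η c k t₁ t₂ t₃) θ)
    (hθ' : IsLeeForm (omegaT α β γ η c k t₁ t₂ t₃) θ') : θ = θ' := by
  obtain ⟨A, hA⟩ := h.exists_frameField hE 1 0 0 0
  obtain ⟨B, hB⟩ := h.exists_frameField hE 0 1 0 0
  obtain ⟨C, hC⟩ := h.exists_frameField hE 0 0 1 0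
  obtain ⟨F, hF⟩ := h.exists_frameField hE 0 0 0 1
  funext p
  have key : ∀ {U V W : VecField I M}, IsSmoothVecField U → IsSmoothVecField V →
      IsSmoothVecField W → θ.wedgeTwoApply (omegaT α β γ η c k t₁ t₂ t₃) p (U p) (V p) (W p) =
        θ'.wedgeTwoApply (omegaT α β γ η c k t₁ t₂ t₃) p (U p) (V p) (W p) := fun hU hV hW =>
    neg_injective ((hθ.extDeriv_eq _ _ _ hU hV hW p).symm.trans
      (hθ'.extDeriv_eq _ _ _ hU hV hW p))
  have h1 := key hA.smooth hB.smooth hC.smooth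
  have h2 := key hA.smooth hB.smooth hF.smooth
  have h3 := key hA.smooth hC.smooth hF.smooth
  have h4 := key hB.smooth hC.smooth hF.smooth
  simp only [OneForm.wedgeTwoApply, omegaT_apply, hA.α_eq, hA.β_eq, hA.γ_eq, hA.η_eq, hB.α_eq,
    hB.β_eq, hB.γ_eq, hB.η_eq, hC.α_eq, hC.β_eq, hC.γ_eq, hC.η_eq, hF.α_eq, hF.β_eq, hF.γ_eq,
    hF.η_eq] at h1 h2 h3 h4
  have hdet : t₁ * t₂ - c * k * t₃ ^ 2 ≠ 0 := sub_ne_zero.2 hd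
  have eA : θ p (A p) = θ' p (A p) := mul_left_cancel₀ hdet (by
    linear_combination t₁ * h1 + c * t₃ * h3)
  have eB : θ p (B p) = θ' p (B p) := mul_left_cancel₀ hdet (by
    linear_combination -t₂ * h2 + c * t₃ * h4)
  have eC : θ p (C p) = θ' p (C p) := mul_left_cancel₀ (left_ne_zero_of_mul h12) (by
    linear_combination -h3 - k * t₃ * eA)
  have eF : θ p (F p) = θ' p (F p) := mul_left_cancel₀ (right_ne_zero_of_mul h12) (by
    linear_combination h4 + k * t₃ * eB)
  refine ContinuousLinearMap.ext fun v => ?_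
  have hv : v = α p v • A p + β p v • B p + γ p v • C p + η p v • F p := by
    apply h.ext_vector <;> simp only [map_add, map_smul, smul_eq_mul, hA.α_eq, hA.β_eq, hA.γ_eq,
      hA.η_eq, hB.α_eq, hB.β_eq, hB.γ_eq, hB.η_eq, hC.α_eq, hC.β_eq, hC.γ_eq, hC.η_eq, hF.α_eq,
      hF.β_eq, hF.γ_eq, hF.η_eq] <;> ring
  rw [hv]
  simp only [map_add, map_smul, eA, eB, eC, eF]

end IsSolvCoframe

/-- The conformal factor of every infinitesimal automorphism of `omegaT` is `k γ(X)`, and the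
extended Lee homomorphism vanishes. -/
theorem IsInvariantSolvCoframe.isConformalAlong_and_isLeeHomValue_iff [I.Boundaryless]
    [FiniteDimensional ℝ E] (hE : Module.finrank ℝ E = 4) [CompactSpace M] [MulAction Circle M]
    {α β γ η : OneForm I M} {c k : ℝ} (h : IsInvariantSolvCoframe α β γ η c k)
    (hact : ContMDiff ((𝓡 1).prod I) I ∞ (fun q : Circle × M => q.1 • q.2))
    (hconst : ∀ f : M → ℝ, IsLocallyConstant f → ∀ p q, f p = f q)
    {t₁ t₂ t₃ : ℝ} (h12 : t₁ * t₂ ≠ 0) (hd : t₁ * t₂ ≠ c * k * t₃ ^ 2)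
    {X : VecField I M} (hX : IsInfinitesimalAut (omegaT α β γ η c k t₁ t₂ t₃) X) :
    IsConformalAlong X (omegaT α β γ η c k t₁ t₂ t₃) (fun p => k * γ p (X p)) ∧
      ∀ l : M → ℝ, IsLeeHomValue (omegaT α β γ η c k t₁ t₂ t₃) X l ↔ l = 0 := by
  obtain ⟨hXs, f, hf⟩ := hX
  -- Any conformal factor along `X` is the same function, so the value of the Lee homomorphism does
  -- not depend on the choice of μ.
  have hμ : ∀ {μ : M → ℝ}, IsConformalAlong X (omegaT α β γ η c k t₁ t₂ t₃) μ →
      μ = fun p => k * γ p (X p) := fun hμ =>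
    funext (h.conformalFactor_eq hE hact hconst h12 hd hXs hμ)
  rw [hμ hf] at hf
  have hlee := h.isLeeForm_omegaT t₁ t₂ t₃
  have hsum : ∀ p, k * γ p (X p) + (-k • γ) p (X p) = 0 := fun p => by
    change k * γ p (X p) + -k * γ p (X p) = 0
    ring
  refine ⟨hf, fun l => ⟨?_, ?_⟩⟩
  · rintro ⟨θ, μ, hθ, hμ', hl⟩
    funext p
    rw [hl, hμ hμ', h.eq_of_isLeeForm hE h12 hd hθ hlee]
    exact hsum p
  · rintro rfl
    exact ⟨_, _, hlee, hf, fun p => (hsum p).symm⟩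

end LeeForm

/-! ### The main theorem. -/

theorem corollary4
    (k : ℝ) (hk : ∃ m : ℤ, m ≠ 2 ∧ Real.exp k + Real.exp (-k) = m)
    (Γ : Subgroup (SolvGroup k)) [DiscreteTopology Γ] [CompactSpace (SolvGroup k ⧸ Γ)]
    (n : ℤ) (hn : n ≠ 0) (lam : ℝ)
    {M : Type*} [TopologicalSpace M] [T2Space M] [SecondCountableTopology M]
    [ChartedSpace (EuclideanSpace ℝ (Fin 4)) M] [IsManifold (𝓡 4) ∞ M] [MulAction Circle M]
    (π : M → SolvGroup k ⧸ Γ)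
    (hπ : IsPrincipalCircleBundle (I := 𝓡 4) 𝓘(ℝ, ℝ × ℝ × ℝ) π)
    (α β γ η : OneForm (𝓡 4) M)
    (hα : α = OneForm.pullback 𝓘(ℝ, ℝ × ℝ × ℝ) π (SolvGroup.descend Γ (SolvGroup.alphaG k)))
    (hβ : β = OneForm.pullback 𝓘(ℝ, ℝ × ℝ × ℝ) π (SolvGroup.descend Γ (SolvGroup.betaG k)))
    (hγ : γ = OneForm.pullback 𝓘(ℝ, ℝ × ℝ × ℝ) π (SolvGroup.descend Γ (SolvGroup.gammaG k)))
    (hη : IsConnectionForm η) (hcurv : IsExtDeriv η ((n * lam) • α.wedge β)) :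
    (∀ t₁ t₂ t₃ : ℝ, t₁ * t₂ ≠ 0 → t₁ * t₂ ≠ n * k * lam * t₃ ^ 2 →
      ∀ X : VecField (𝓡 4) M,
        IsInfinitesimalAut (omegaT α β γ η (n * lam) k t₁ t₂ t₃) X →
          IsConformalAlong X (omegaT α β γ η (n * lam) k t₁ t₂ t₃) (fun p => k * γ p (X p)) ∧
          ∀ l : M → ℝ, IsLeeHomValue (omegaT α β γ η (n * lam) k t₁ t₂ t₃) X l ↔ l = 0) ∧
    (∀ s₁ s₂ s₃ : ℝ, s₁ * s₂ ≠ 0 → s₁ * s₂ ≠ n * lam * k * s₃ ^ 2 →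
      ∀ X : VecField (𝓡 4) M,
        IsInfinitesimalAut (omegaS α β γ η (n * lam) k s₁ s₂ s₃) X →
          IsConformalAlong X (omegaS α β γ η (n * lam) k s₁ s₂ s₃) (fun p => -(k * γ p (X p))) ∧
          ∀ l : M → ℝ, IsLeeHomValue (omegaS α β γ η (n * lam) k s₁ s₂ s₃) X l ↔ l = 0) := by
  subst hα hβ hγ
  have hE : Module.finrank ℝ (EuclideanSpace ℝ (Fin 4)) = 4 := finrank_euclideanSpace_fin
  have h := SolvGroup.isInvariantSolvCoframe hE hπ hη hcurv
  have := hπ.compactSpace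
  have hconst : ∀ f : M → ℝ, IsLocallyConstant f → ∀ p q, f p = f q := fun _ hf =>
    hπ.eq_of_isLocallyConstant hf
  refine ⟨fun t₁ t₂ t₃ h12 hd X hX => ?_, fun s₁ s₂ s₃ h12 hd X hX => ?_⟩
  · exact h.isConformalAlong_and_isLeeHomValue_iff hE hπ.contMDiff_smul hconst h12
      (by rwa [mul_right_comm (n : ℝ) lam k]) hX
  -- The second family is the first for the swapped coframe, with both signs reversed; their product
  -- in the nondegeneracy condition is unaffected.
  · rw [omegaS_eq_omegaT] at hX ⊢
    have h1 := h.symm.isConformalAlong_and_isLeeHomValue_iff hE hπ.contMDiff_smul hconst h12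
      (by rwa [neg_mul_neg]) hX
    simpa only [neg_mul] using h1
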